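/- Let $\sigma$ be a measure on $(0,\infty)$ with $\int_{(0,\infty)}(1\wedge\tau)\,d\sigma(\tau)<\infty$ and $\sigma((0,\infty))=\infty$, and let $S=(S(t))_{t\ge 0}$ be a subordinator (a process with $S(0)=0$, stationary independent increments and non-decreasing right-continuous paths) without drift and with Lévy measure $\sigma$, i.e. $\mathbb E[e^{-\lambda S(t)}]=e^{-t\Phi(\lambda)}$ with $\Phi(\lambda)=\int_{(0,\infty)}(1-e^{-\lambda\tau})\,d\sigma(\tau)$ for $t,\lambda\ge 0$. Let $k(t)=\sigma((t,\infty))$ and $\mathcal K(\lambda)=\int_0^\infty e^{-\lambda t}k(t)\,dt$. Let $E(t)=\inf\{r\ge 0: S(r)\ge t\}$ be the inverse process and $G_t(\tau)$ the density of the law of $E(t)$ with respect to Lebesgue measure. For $x\in\mathbb R^d$ let $v(x,t)=(2\pi t)^{-d/2}e^{-|x|^2/(2t)}$ be the heat kernel of $\partial_t u=\tfrac12\Delta u$, and put $$v^E(x,t)=\int_0^\infty v(x,\tau)\,G_t(\tau)\,d\tau,\qquad M_t\big(v^E(x,t)\big)=\frac1t\int_0^t v^E(x,r)\,dr .$$ Assume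 that for some constants $C>0$ and $s>0$ $$\mathcal K(\lambda)\sim C\,\lambda^{-1}\log(1/\lambda)^{-1-s},\qquad \lambda\to 0^+ .$$ Then, for fixed $x$ and $t\to\infty$ (where $f\sim g$ means $f/g\to1$): 1. if $d=1$, then for every $x\in\mathbb R$ $$M_t\big(v^E(x,t)\big)\sim \sqrt{\tfrac{C}{2}}\;\log(t)^{-(1+s)/2}\,\exp\!\Big(-C'\sqrt2\,|x|\,\log(t)^{-(1+s)/2}\Big),\qquad C'=\sqrt C;$$ 2. if $d=2$, then for every $x\in\mathbb R^2\setminus\{0\}$ $$M_t\big(v^E(x,t)\big)\sim -\frac{C}{\pi}\,\log(t)^{-1-s}\,\ln\!\Big(C'|x|\,\log(t)^{-(1+s)/2}\Big),\qquad C'=\sqrt{2C};$$ 3. if $d\ge 3$, then for every $x\in\mathbb R^d\setminus\{0\}$ $$M_t\big(v^E(x,t)\big)\sim \frac{C\,\Gamma(d/2-1)}{2\pi^{d/2}}\,|x|^{2-d}\,\log(t)^{-1-s}.$$ -/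

import Mathlib

open MeasureTheory ProbabilityTheory Filter Asymptotics
open scoped Topology NNReal ENNReal

noncomputable section

namespace SubordinatedHeat

/-- `σ` is the Lévy measure of a subordinator with infinite activity: a measure on `(0, ∞)`
with `∫ (1 ∧ τ) dσ(τ) < ∞` and `σ((0, ∞)) = ∞`. -/
structure IsLevyMeasure (σ : Measure ℝ) : Prop where
  support : σ (Set.Iic 0) = 0
  lintegral_min_lt_top : ∫⁻ τ in Set.Ioi 0, ENNReal.ofReal (min 1 τ) ∂σ < ∞
  infinite : σ (Set.Ioi 0) = ∞

/-- The Laplace exponent `Φ(lam) = ∫_{(0, ∞)} (1 - e^{-lam τ}) dσ(τ)` (no drift). -/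
def laplaceExponent (σ : Measure ℝ) (lam : ℝ) : ℝ :=
  ∫ τ in Set.Ioi 0, (1 - Real.exp (-lam * τ)) ∂σ

/-- The kernel `k(t) = σ((t, ∞))`. -/
def kernel (σ : Measure ℝ) (t : ℝ) : ℝ := σ.real (Set.Ioi t)

/-- The Laplace transform `𝒦(lam) = ∫_0^∞ e^{-lam t} k(t) dt` of the kernel. -/
def kernelLaplace (σ : Measure ℝ) (lam : ℝ) : ℝ :=
  ∫ t in Set.Ioi (0 : ℝ), Real.exp (-lam * t) * kernel σ t

/-- `S` is a subordinator without drift and with Lévy measure `σ`: a process started at `0`, with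
independent and stationary increments, whose paths are almost surely non-decreasing and
right-continuous, and with `𝔼[e^{-lam S(t)}] = e^{-t Φ(lam)}`. -/
structure IsSubordinator {Ω : Type*} [MeasurableSpace Ω] (S : ℝ≥0 → Ω → ℝ) (σ : Measure ℝ)
    (P : Measure Ω) : Prop where
  measurable : ∀ t, Measurable (S t)
  zero : ∀ᵐ ω ∂P, S 0 ω = 0
  monotone : ∀ᵐ ω ∂P, Monotone fun t => S t ω
  rightContinuous : ∀ᵐ ω ∂P, ∀ t, ContinuousWithinAt (fun r => S r ω) (Set.Ici t) t
  indepIncrements : HasIndepIncrements S P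
  stationaryIncrements :
    ∀ t h, IdentDistrib (fun ω => S (t + h) ω - S t ω) (fun ω => S h ω) P P
  laplace : ∀ (t : ℝ≥0) (lam : ℝ), 0 ≤ lam →
    ∫ ω, Real.exp (-lam * S t ω) ∂P = Real.exp (-(t : ℝ) * laplaceExponent σ lam)

/-- The inverse process `E(t) = inf {r ≥ 0 : S(r) ≥ t}`. -/
def inverseProcess {Ω : Type*} (S : ℝ≥0 → Ω → ℝ) (t : ℝ) (ω : Ω) : ℝ :=
  ((sInf {r : ℝ≥0 | t ≤ S r ω} : ℝ≥0) : ℝ)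

/-- The marginal density `G_t(τ)` of `E(t)` with respect to Lebesgue measure. -/
def inverseDensity {Ω : Type*} [MeasurableSpace Ω] (S : ℝ≥0 → Ω → ℝ) (P : Measure Ω)
    (t τ : ℝ) : ℝ :=
  (pdf (inverseProcess S t) P volume τ).toReal

/-- The heat kernel `v(x, t) = (2πt)^{-d/2} e^{-|x|² / (2t)}` of `∂u/∂t = ½ Δu` on `ℝ^d`. -/
def heatKernel {d : ℕ} (x : EuclideanSpace ℝ (Fin d)) (t : ℝ) : ℝ :=
  1 / (2 * Real.pi * t) ^ ((d : ℝ) / 2) * Real.exp (-(‖x‖ ^ 2 / (2 * t)))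

/-- The subordinated heat kernel `v^E(x, t) = ∫_0^∞ v(x, τ) G_t(τ) dτ`. -/
def subordinatedKernel {Ω : Type*} [MeasurableSpace Ω] (S : ℝ≥0 → Ω → ℝ) (P : Measure Ω)
    {d : ℕ} (x : EuclideanSpace ℝ (Fin d)) (t : ℝ) : ℝ :=
  ∫ τ in Set.Ioi (0 : ℝ), heatKernel x τ * inverseDensity S P t τ

/-- The Cesàro mean `M_t(f) = (1/t) ∫_0^t f(r) dr`. -/
def cesaroMean (f : ℝ → ℝ) (t : ℝ) : ℝ := 1 / t * ∫ r in (0 : ℝ)..t, f r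

end SubordinatedHeat

end

namespace SubordinatedHeat

/-! ### Convergence of moments on the unit interval -/

/-! The whole argument runs through the Laplace transform in `t`. Write `Φ` for the Laplace exponent
and `R(φ) = ∫ e^{-τφ} v(x, τ) dτ` for the Green function of the heat kernel. The layer-cake formula
gives `𝒦(λ) = Φ(λ)/λ`. The density of `E(t)` is the convolution of the tail `k` with the law of
`S(τ)`, and its transform in `t` is `(Φ(λ)/λ) e^{-τΦ(λ)}`. Tonelli then shows that `v^E(x, ·)` has
transform `u(λ) = (Φ(λ)/λ) R(Φ(λ))`.

The hypothesis on `𝒦` says that `Φ(1/t) ~ C log(t)^{-1-s}`, which tends to `0`, so only the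
behaviour of `R` at `0` matters. It is `R(φ) ~ (2φ)^{-1/2}` for `d = 1`, `R(φ) ~ (2π)⁻¹ log(1/φ)`
for `d = 2`, and convergence to the Newtonian potential for `d ≥ 3` (`tendsto_resolvent_one`,
`tendsto_resolvent_two`, `tendsto_resolvent_of_three_le`). In each case `Φ(1/t) R(Φ(1/t))` is
equivalent to a slowly varying function `g(t)`. Hence `u` is regularly varying of index `-1` at
zero, and Karamata's theorem (`tendsto_setLIntegral_div_laplace`) gives `(1/t) ∫_0^t v^E ~ u(1/t)/t
~ g(t)`; this is `cesaroMean_isEquivalent`.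

Both Karamata's theorem and the uniqueness of Laplace transforms come from one device: the
substitution `x = e^{-λt}` turns Laplace transforms at `λ, 2λ, 3λ, ...` into the moments of a
measure on `[0, 1]`, which Weierstrass approximation controls. Uniqueness identifies the density of
`E(t)` only for almost every `t`, which is enough because Cesàro means integrate over `t`. -/

theorem integrable_of_continuous_of_ae_mem_Icc {ρ : Measure ℝ} [IsFiniteMeasure ρ]
    (hρ : ∀ᵐ x ∂ρ, x ∈ Set.Icc (0 : ℝ) 1) {f : ℝ → ℝ} (hf : Continuous f) : Integrable f ρ := by
  obtain ⟨B, hB⟩ := isCompact_Icc.exists_bound_of_continuousOn (s := Set.Icc (0 : ℝ) 1)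
    hf.continuousOn
  exact Integrable.of_bound hf.aestronglyMeasurable B (hρ.mono fun x hx => hB x hx)

theorem tendsto_integral_polynomial {ι : Type*} {l : Filter ι} {ρ : ι → Measure ℝ}
    {ρ₀ : Measure ℝ} [IsFiniteMeasure ρ₀] (hfin : ∀ᶠ i in l, IsFiniteMeasure (ρ i))
    (hsupp : ∀ᶠ i in l, ∀ᵐ x ∂ρ i, x ∈ Set.Icc (0 : ℝ) 1)
    (hsupp₀ : ∀ᵐ x ∂ρ₀, x ∈ Set.Icc (0 : ℝ) 1)
    (hmom : ∀ n : ℕ, Tendsto (fun i => ∫ x, x ^ n ∂ρ i) l (𝓝 (∫ x, x ^ n ∂ρ₀)))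
    (p : Polynomial ℝ) :
    Tendsto (fun i => ∫ x, p.eval x ∂ρ i) l (𝓝 (∫ x, p.eval x ∂ρ₀)) := by
  have key : ∀ (ν : Measure ℝ) [IsFiniteMeasure ν], (∀ᵐ x ∂ν, x ∈ Set.Icc (0 : ℝ) 1) →
      ∫ x, p.eval x ∂ν = ∑ n ∈ Finset.range (p.natDegree + 1), p.coeff n * ∫ x, x ^ n ∂ν := by
    intro ν _ hν
    simp_rw [Polynomial.eval_eq_sum_range]
    rw [integral_finsetSum]
    · simp_rw [integral_const_mul]
    · intro n _
      exact integrable_of_continuous_of_ae_mem_Icc hν (by fun_prop)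
  rw [key ρ₀ hsupp₀]
  refine (tendsto_finsetSum _ fun n _ => (hmom n).const_mul (p.coeff n)).congr' ?_
  filter_upwards [hfin, hsupp] with i hi hi'
  exact (key (ρ i) hi').symm

/-- Convergence of all moments of measures on `[0, 1]` implies weak convergence. -/
theorem tendsto_integral_of_tendsto_moments {ι : Type*} {l : Filter ι} {ρ : ι → Measure ℝ}
    {ρ₀ : Measure ℝ} [IsFiniteMeasure ρ₀] (hfin : ∀ᶠ i in l, IsFiniteMeasure (ρ i))
    (hsupp : ∀ᶠ i in l, ∀ᵐ x ∂ρ i, x ∈ Set.Icc (0 : ℝ) 1)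
    (hsupp₀ : ∀ᵐ x ∂ρ₀, x ∈ Set.Icc (0 : ℝ) 1)
    (hmom : ∀ n : ℕ, Tendsto (fun i => ∫ x, x ^ n ∂ρ i) l (𝓝 (∫ x, x ^ n ∂ρ₀)))
    {f : ℝ → ℝ} (hf : Continuous f) :
    Tendsto (fun i => ∫ x, f x ∂ρ i) l (𝓝 (∫ x, f x ∂ρ₀)) := by
  rw [Metric.tendsto_nhds]
  intro ε hε
  set m : ℝ := ρ₀.real Set.univ with hm
  have hm0 : 0 ≤ m := measureReal_nonneg
  -- Three errors occur: `δ(m + 1)` and `δm` for replacing `f` by the polynomial under `ρ i` and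
  -- under `ρ₀`, and `δ` for the polynomial integrals. Their sum is below `ε`.
  set δ : ℝ := ε / (2 * (m + 1) + 2) with hδ
  have hden : 0 < 2 * (m + 1) + 2 := by linarith
  have hδ0 : 0 < δ := by positivity
  obtain ⟨p, hp⟩ := exists_polynomial_near_of_continuousOn 0 1 f hf.continuousOn δ hδ0
  have hpc : Continuous fun x => p.eval x := p.continuous
  have bound : ∀ (ν : Measure ℝ) [IsFiniteMeasure ν], (∀ᵐ x ∂ν, x ∈ Set.Icc (0 : ℝ) 1) →
      |∫ x, f x ∂ν - ∫ x, p.eval x ∂ν| ≤ δ * ν.real Set.univ := by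
    intro ν _ hν
    rw [← integral_sub (integrable_of_continuous_of_ae_mem_Icc hν hf)
      (integrable_of_continuous_of_ae_mem_Icc hν hpc), ← Real.norm_eq_abs]
    refine norm_integral_le_of_norm_le_const (hν.mono fun x hx => ?_)
    rw [Real.norm_eq_abs, abs_sub_comm]
    exact (hp x hx).le
  -- The total masses vary with `i`; the zeroth moment keeps them eventually below `m + 1`.
  have hmass := hmom 0
  simp only [pow_zero, integral_const, smul_eq_mul, mul_one] at hmass
  have h1 := (Metric.tendsto_nhds.1 hmass) 1 one_pos
  have h2 := (Metric.tendsto_nhds.1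
    (tendsto_integral_polynomial hfin hsupp hsupp₀ hmom p)) δ hδ0
  filter_upwards [hfin, hsupp, h1, h2] with i hi hi' hi1 hi2
  have b1 := bound (ρ i) hi'
  have b2 := bound ρ₀ hsupp₀
  rw [Real.dist_eq] at hi1 hi2 ⊢
  have hi1' : (ρ i).real Set.univ < m + 1 := by
    have := (abs_lt.1 hi1).2
    linarith
  have hε' : δ * (2 * (m + 1) + 2) = ε := by rw [hδ]; field_simp
  have b3 : δ * (ρ i).real Set.univ ≤ δ * (m + 1) := by gcongr
  rw [abs_le] at b1 b2
  rw [abs_lt] at hi2 ⊢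
  constructor <;> nlinarith

/-! ### Laplace transforms of nonnegative functions -/

/-- The Laplace transform of a nonnegative function on `(0, ∞)`. -/
noncomputable def laplace (H : ℝ → ℝ≥0∞) (lam : ℝ) : ℝ≥0∞ :=
  ∫⁻ t in Set.Ioi (0 : ℝ), ENNReal.ofReal (Real.exp (-lam * t)) * H t

/-- The image of `e^{-lam t} H(t) dt` under `t ↦ e^{-lam t}`. -/
noncomputable def expMeasure (H : ℝ → ℝ≥0∞) (lam : ℝ) : Measure ℝ :=
  ((volume.restrict (Set.Ioi (0 : ℝ))).withDensity
    fun t => ENNReal.ofReal (Real.exp (-lam * t)) * H t).map fun t => Real.exp (-lam * t)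

theorem lintegral_expMeasure {H : ℝ → ℝ≥0∞} (hH : Measurable H) (lam : ℝ) {f : ℝ → ℝ≥0∞}
    (hf : Measurable f) :
    ∫⁻ x, f x ∂expMeasure H lam = ∫⁻ t in Set.Ioi (0 : ℝ),
      ENNReal.ofReal (Real.exp (-lam * t)) * H t * f (Real.exp (-lam * t)) := by
  rw [expMeasure, lintegral_map hf (by fun_prop), lintegral_withDensity_eq_lintegral_mul _
    (by fun_prop) (by fun_prop)]
  rfl

/-- The factor `x ^ n` contributes `e^{-nλt}` and the density already carries one factor `e^{-λt}`,
hence the index `n + 1`. -/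
theorem lintegral_pow_expMeasure {H : ℝ → ℝ≥0∞} (hH : Measurable H) (lam : ℝ) (n : ℕ) :
    ∫⁻ x, ENNReal.ofReal (x ^ n) ∂expMeasure H lam = laplace H ((n + 1) * lam) := by
  rw [lintegral_expMeasure hH lam (by fun_prop), laplace]
  refine lintegral_congr fun t => ?_
  rw [mul_right_comm, ← ENNReal.ofReal_mul (Real.exp_pos _).le, ← Real.exp_nat_mul,
    ← Real.exp_add]
  congr 3
  ring

theorem expMeasure_univ {H : ℝ → ℝ≥0∞} (hH : Measurable H) (lam : ℝ) :
    expMeasure H lam Set.univ = laplace H lam := by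
  have := lintegral_pow_expMeasure hH lam 0
  simpa using this

theorem ae_mem_Icc_expMeasure {H : ℝ → ℝ≥0∞} {lam : ℝ} (hlam : 0 < lam) :
    ∀ᵐ x ∂expMeasure H lam, x ∈ Set.Icc (0 : ℝ) 1 := by
  rw [expMeasure]
  refine (ae_map_iff (by fun_prop) measurableSet_Icc).2 ?_
  refine (withDensity_absolutelyContinuous _ _).ae_le ?_
  filter_upwards [ae_restrict_mem measurableSet_Ioi] with t ht
  have ht : 0 < t := ht
  refine ⟨(Real.exp_pos _).le, Real.exp_le_one_iff.2 ?_⟩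
  nlinarith

theorem integral_pow_expMeasure {H : ℝ → ℝ≥0∞} (hH : Measurable H) {lam : ℝ} (hlam : 0 < lam)
    (n : ℕ) : ∫ x, x ^ n ∂expMeasure H lam = (laplace H ((n + 1) * lam)).toReal := by
  rw [integral_eq_lintegral_of_nonneg_ae _ (by fun_prop), lintegral_pow_expMeasure hH]
  exact (ae_mem_Icc_expMeasure hlam).mono fun x hx => pow_nonneg hx.1 n

/-- Uniqueness of Laplace transforms. -/
theorem ae_eq_of_laplace_eq {H₁ H₂ : ℝ → ℝ≥0∞} (h₁ : Measurable H₁) (h₂ : Measurable H₂)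
    (hfin : ∀ lam, 0 < lam → laplace H₁ lam ≠ ∞)
    (heq : ∀ lam, 0 < lam → laplace H₁ lam = laplace H₂ lam) :
    H₁ =ᵐ[volume.restrict (Set.Ioi (0 : ℝ))] H₂ := by
  have i1 : IsFiniteMeasure (expMeasure H₁ 1) :=
    ⟨by rw [expMeasure_univ h₁]; exact (hfin 1 one_pos).lt_top⟩
  have i2 : IsFiniteMeasure (expMeasure H₂ 1) :=
    ⟨by rw [expMeasure_univ h₂, ← heq 1 one_pos]; exact (hfin 1 one_pos).lt_top⟩
  -- The moments of these measures are the Laplace transforms at the positive integers, so they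
  -- agree. The moment theorem, applied to a constant family, then forces the integrals of
  -- continuous functions to agree.
  have hE : expMeasure H₁ 1 = expMeasure H₂ 1 := by
    refine ext_of_forall_integral_eq_of_IsFiniteMeasure fun f => ?_
    have ht := tendsto_integral_of_tendsto_moments (l := (atTop : Filter ℕ))
      (ρ := fun _ => expMeasure H₁ 1) (ρ₀ := expMeasure H₂ 1)
      (Eventually.of_forall fun _ => i1)
      (Eventually.of_forall fun _ => ae_mem_Icc_expMeasure one_pos)
      (ae_mem_Icc_expMeasure one_pos) (fun n => by
        rw [integral_pow_expMeasure h₁ one_pos, integral_pow_expMeasure h₂ one_pos,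
          heq _ (by positivity)]
        exact tendsto_const_nhds) f.continuous
    exact tendsto_nhds_unique tendsto_const_nhds ht
  -- The map `x ↦ -log x` undoes the substitution, so the weighted densities can be compared.
  have hlog : ∀ H : ℝ → ℝ≥0∞, (expMeasure H 1).map (fun x => -Real.log x) =
      (volume.restrict (Set.Ioi (0 : ℝ))).withDensity
        fun t => ENNReal.ofReal (Real.exp (-1 * t)) * H t := by
    intro H
    rw [expMeasure, Measure.map_map (by fun_prop) (by fun_prop)]
    have hid : ((fun x => -Real.log x) ∘ fun t => Real.exp (-1 * t)) = id := by
      funext t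
      simp
    rw [hid, Measure.map_id]
  have hD := (hlog H₁).symm.trans ((congrArg _ hE).trans (hlog H₂))
  rw [withDensity_eq_iff (by fun_prop) (by fun_prop) (hfin 1 one_pos)] at hD
  filter_upwards [hD] with t ht
  exact (ENNReal.mul_right_inj (by simp [Real.exp_pos]) ENNReal.ofReal_ne_top).1 ht

/-! ### Karamata's Tauberian theorem -/

/-- A continuous approximation of the indicator function of `[b, ∞)`. -/
noncomputable def ramp (b δ x : ℝ) : ℝ := min 1 (max 0 ((x - b) / δ))

theorem continuous_ramp (b δ : ℝ) : Continuous (ramp b δ) := by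
  unfold ramp
  fun_prop

theorem ramp_nonneg (b δ x : ℝ) : 0 ≤ ramp b δ x := le_min zero_le_one (le_max_left _ _)

theorem ramp_le_one (b δ x : ℝ) : ramp b δ x ≤ 1 := min_le_left _ _

theorem ramp_of_le {b δ x : ℝ} (hδ : 0 < δ) (hx : x ≤ b) : ramp b δ x = 0 := by
  have : (x - b) / δ ≤ 0 := div_nonpos_of_nonpos_of_nonneg (by linarith) hδ.le
  simp [ramp, max_eq_left this]

theorem ramp_of_ge {b δ x : ℝ} (hδ : 0 < δ) (hx : b + δ ≤ x) : ramp b δ x = 1 := by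
  have : 1 ≤ (x - b) / δ := by rw [le_div_iff₀ hδ]; linarith
  exact min_eq_left (this.trans (le_max_right _ _))

/-- The function `x⁻¹` on `[e⁻¹, ∞)`, extended by zero. -/
noncomputable def cutInv (x : ℝ) : ℝ := (Set.Ici (Real.exp (-1))).indicator (fun x => x⁻¹) x

/-- A continuous approximation of `cutInv`. -/
noncomputable def rampInv (b δ x : ℝ) : ℝ := ramp b δ x * (max x (Real.exp (-1)))⁻¹

theorem continuous_rampInv (b δ : ℝ) : Continuous (rampInv b δ) := by
  refine (continuous_ramp b δ).mul (Continuous.inv₀ (by fun_prop) fun x => ?_)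
  exact ((Real.exp_pos _).trans_le (le_max_right _ _)).ne'

theorem rampInv_nonneg (b δ x : ℝ) : 0 ≤ rampInv b δ x :=
  mul_nonneg (ramp_nonneg _ _ _)
    (inv_nonneg.2 ((Real.exp_pos _).le.trans (le_max_right _ _)))

theorem measurable_cutInv : Measurable cutInv :=
  measurable_inv.indicator measurableSet_Ici

theorem cutInv_nonneg (x : ℝ) : 0 ≤ cutInv x :=
  Set.indicator_nonneg (fun _ hx => inv_nonneg.2 ((Real.exp_pos _).le.trans hx)) x

theorem rampInv_le_exp (b δ x : ℝ) : rampInv b δ x ≤ Real.exp 1 := by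
  have h1 : (max x (Real.exp (-1)))⁻¹ ≤ (Real.exp (-1))⁻¹ :=
    inv_anti₀ (Real.exp_pos _) (le_max_right _ _)
  rw [← Real.exp_neg, neg_neg] at h1
  calc rampInv b δ x ≤ 1 * Real.exp 1 :=
        mul_le_mul (ramp_le_one _ _ _) h1
          (inv_nonneg.2 ((Real.exp_pos _).le.trans (le_max_right _ _))) zero_le_one
    _ = _ := one_mul _

theorem rampInv_le_cutInv {δ : ℝ} (hδ : 0 < δ) (x : ℝ) :
    rampInv (Real.exp (-1)) δ x ≤ cutInv x := by
  by_cases hx : Real.exp (-1) ≤ x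
  · rw [cutInv, Set.indicator_of_mem (by exact hx), rampInv, max_eq_left hx]
    exact mul_le_of_le_one_left (inv_nonneg.2 ((Real.exp_pos _).le.trans hx))
      (ramp_le_one _ _ _)
  · rw [rampInv, ramp_of_le hδ (not_le.1 hx).le, zero_mul]
    exact cutInv_nonneg x

theorem cutInv_le_rampInv {δ : ℝ} (hδ : 0 < δ) (x : ℝ) :
    cutInv x ≤ rampInv (Real.exp (-1) - δ) δ x := by
  by_cases hx : Real.exp (-1) ≤ x
  · rw [cutInv, Set.indicator_of_mem (by exact hx), rampInv, max_eq_left hx,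
      ramp_of_ge hδ (by linarith), one_mul]
  · rw [cutInv, Set.indicator_of_notMem (by exact hx)]
    exact rampInv_nonneg _ _ _

theorem rampInv_le_add {δ : ℝ} (hδ : 0 < δ) (x : ℝ) :
    rampInv (Real.exp (-1) - δ) δ x ≤ cutInv x +
      (Set.Ioc (Real.exp (-1) - δ) (Real.exp (-1))).indicator (fun _ => Real.exp 1) x := by
  have h0 : 0 ≤ (Set.Ioc (Real.exp (-1) - δ) (Real.exp (-1))).indicator
      (fun _ => Real.exp 1) x := Set.indicator_nonneg (fun _ _ => (Real.exp_pos _).le) x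
  by_cases hx : Real.exp (-1) ≤ x
  · refine le_add_of_le_of_nonneg ?_ h0
    rw [cutInv, Set.indicator_of_mem (by exact hx), rampInv, max_eq_left hx,
      ramp_of_ge hδ (by linarith), one_mul]
  · by_cases hx' : x ≤ Real.exp (-1) - δ
    · rw [rampInv, ramp_of_le hδ hx', zero_mul]
      exact add_nonneg (cutInv_nonneg x) h0
    · rw [Set.indicator_of_mem (show x ∈ Set.Ioc _ _ from ⟨not_le.1 hx', (not_le.1 hx).le⟩)]
      exact le_add_of_nonneg_of_le (cutInv_nonneg x) (rampInv_le_exp _ _ _)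

theorem cutInv_le_add {δ : ℝ} (hδ : 0 < δ) (x : ℝ) :
    cutInv x ≤ rampInv (Real.exp (-1)) δ x +
      (Set.Icc (Real.exp (-1)) (Real.exp (-1) + δ)).indicator (fun _ => Real.exp 1) x := by
  have h0 : 0 ≤ (Set.Icc (Real.exp (-1)) (Real.exp (-1) + δ)).indicator
      (fun _ => Real.exp 1) x := Set.indicator_nonneg (fun _ _ => (Real.exp_pos _).le) x
  by_cases hx : Real.exp (-1) ≤ x
  · rw [cutInv, Set.indicator_of_mem (by exact hx)]
    by_cases hx' : Real.exp (-1) + δ ≤ x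
    · refine le_add_of_le_of_nonneg ?_ h0
      rw [rampInv, max_eq_left hx, ramp_of_ge hδ hx', one_mul]
    · rw [Set.indicator_of_mem (show x ∈ Set.Icc _ _ from ⟨hx, (not_le.1 hx').le⟩)]
      refine le_add_of_nonneg_of_le (rampInv_nonneg _ _ _) ?_
      have := inv_anti₀ (Real.exp_pos _) hx
      rwa [← Real.exp_neg, neg_neg] at this
  · rw [cutInv, Set.indicator_of_notMem (by exact hx)]
    exact add_nonneg (rampInv_nonneg _ _ _) h0

theorem integral_cutInv : ∫ x in Set.Icc (0 : ℝ) 1, cutInv x = 1 := by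
  have he : Real.exp (-1) ≤ 1 := Real.exp_le_one_iff.2 (by norm_num)
  have hset : Set.Icc (0 : ℝ) 1 ∩ Set.Ici (Real.exp (-1)) = Set.Icc (Real.exp (-1)) 1 := by
    ext x
    simp only [Set.mem_inter_iff, Set.mem_Icc, Set.mem_Ici]
    exact ⟨fun h => ⟨h.2, h.1.2⟩, fun h => ⟨⟨(Real.exp_pos _).le.trans h.1, h.2⟩, h.1⟩⟩
  unfold cutInv
  rw [setIntegral_indicator measurableSet_Ici, hset, integral_Icc_eq_integral_Ioc,
    ← intervalIntegral.integral_of_le he, integral_inv_of_pos (Real.exp_pos _) one_pos]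
  simp

theorem integrable_cutInv (μ : Measure ℝ) [IsFiniteMeasure μ] : Integrable cutInv μ := by
  refine Integrable.of_bound measurable_cutInv.aestronglyMeasurable (Real.exp 1)
    (Eventually.of_forall fun x => ?_)
  rw [Real.norm_eq_abs, abs_of_nonneg (cutInv_nonneg x)]
  exact (cutInv_le_rampInv one_pos x).trans (rampInv_le_exp _ _ _)

theorem integral_indicator_Icc_le {a b c : ℝ} (hab : a ≤ b) (hc : 0 ≤ c) {s : Set ℝ}
    (hs : MeasurableSet s) (hsub : s ⊆ Set.Icc a b) (μ : Measure ℝ) (hμ : μ ≤ volume) :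
    ∫ x, s.indicator (fun _ => c) x ∂μ ≤ c * (b - a) := by
  rw [integral_indicator_const _ hs, smul_eq_mul, mul_comm]
  refine mul_le_mul_of_nonneg_left ?_ hc
  refine ENNReal.toReal_le_of_le_ofReal (by linarith) ?_
  calc μ s ≤ volume (Set.Icc a b) := (hμ s).trans (measure_mono hsub)
    _ = _ := Real.volume_Icc

/-- Karamata's Tauberian theorem, for a Laplace transform regularly varying of index `-1` at
zero. -/
theorem tendsto_setLIntegral_div_laplace {H : ℝ → ℝ≥0∞} (hH : Measurable H) {u : ℝ → ℝ}
    (hu : ∀ lam, 0 < lam → laplace H lam = ENNReal.ofReal (u lam))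
    (hpos : ∀ lam, 0 < lam → 0 < u lam)
    (hvar : ∀ n : ℕ, Tendsto (fun lam => u ((n + 1) * lam) / u lam) (𝓝[>] 0)
      (𝓝 ((n + 1 : ℝ)⁻¹))) :
    Tendsto (fun lam => (∫⁻ t in Set.Ioc 0 lam⁻¹, H t).toReal / u lam) (𝓝[>] 0) (𝓝 1) := by
  set ρ : ℝ → Measure ℝ := fun lam => (ENNReal.ofReal (u lam))⁻¹ • expMeasure H lam with hρ
  set ρ₀ : Measure ℝ := volume.restrict (Set.Icc (0 : ℝ) 1) with hρ₀
  have hlpos : ∀ᶠ lam : ℝ in 𝓝[>] 0, 0 < lam := eventually_mem_nhdsWithin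
  have hfin : ∀ lam, 0 < lam → IsFiniteMeasure (ρ lam) := fun lam hl => ⟨by
    rw [hρ, Measure.smul_apply, expMeasure_univ hH, hu lam hl, smul_eq_mul,
      ENNReal.inv_mul_cancel (by simpa using hpos lam hl) ENNReal.ofReal_ne_top]
    exact ENNReal.one_lt_top⟩
  have hsupp : ∀ lam, 0 < lam → ∀ᵐ x ∂ρ lam, x ∈ Set.Icc (0 : ℝ) 1 := fun lam hl =>
    Measure.ae_smul_measure (ae_mem_Icc_expMeasure hl) _
  have hsupp₀ : ∀ᵐ x ∂ρ₀, x ∈ Set.Icc (0 : ℝ) 1 := ae_restrict_mem measurableSet_Icc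
  -- The normalised moments are `u((n + 1)λ)/u(λ)`, and their limits `1/(n + 1)` are the moments of
  -- Lebesgue measure on `[0, 1]`.
  have hmom : ∀ n : ℕ, Tendsto (fun lam => ∫ x, x ^ n ∂ρ lam) (𝓝[>] 0)
      (𝓝 (∫ x, x ^ n ∂ρ₀)) := by
    intro n
    have h0 : ∫ x, x ^ n ∂ρ₀ = (n + 1 : ℝ)⁻¹ := by
      rw [hρ₀, integral_Icc_eq_integral_Ioc, ← intervalIntegral.integral_of_le zero_le_one,
        integral_pow]
      simp
    rw [h0]
    refine (hvar n).congr' (hlpos.mono fun lam hl => ?_)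
    have hl' : 0 < (n + 1) * lam := by positivity
    rw [hρ]
    simp only
    rw [integral_smul_measure, integral_pow_expMeasure hH hl, hu _ hl',
      ENNReal.toReal_ofReal (hpos _ hl').le, ENNReal.toReal_inv,
      ENNReal.toReal_ofReal (hpos _ hl).le, smul_eq_mul, div_eq_inv_mul]
  -- At `x = e^{-λt}` the function `cutInv` equals `e^{λt}` for `t ≤ 1/λ` and vanishes beyond, so it
  -- cancels the exponential weight and truncates at `1/λ`.
  have hcut : ∀ lam, 0 < lam →
      (∫⁻ t in Set.Ioc 0 lam⁻¹, H t).toReal / u lam = ∫ x, cutInv x ∂ρ lam := by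
    intro lam hl
    rw [hρ]
    simp only
    rw [integral_smul_measure, ENNReal.toReal_inv, ENNReal.toReal_ofReal (hpos _ hl).le,
      smul_eq_mul, div_eq_inv_mul, integral_eq_lintegral_of_nonneg_ae
        (Eventually.of_forall cutInv_nonneg) measurable_cutInv.aestronglyMeasurable,
      lintegral_expMeasure hH lam measurable_cutInv.ennreal_ofReal,
      ← Set.Ioi_inter_Iic, Set.inter_comm, ← Measure.restrict_restrict measurableSet_Iic,
      ← lintegral_indicator measurableSet_Iic]
    congr 2
    refine lintegral_congr fun t => ?_
    have hiff : t ∈ Set.Iic lam⁻¹ ↔ Real.exp (-lam * t) ∈ Set.Ici (Real.exp (-1)) := by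
      rw [Set.mem_Iic, Set.mem_Ici, Real.exp_le_exp, ← mul_le_mul_iff_of_pos_left hl,
        mul_inv_cancel₀ hl.ne']
      constructor <;> intro h <;> linarith
    by_cases ht : t ∈ Set.Iic lam⁻¹
    · rw [Set.indicator_of_mem ht, cutInv, Set.indicator_of_mem (hiff.1 ht), mul_right_comm,
        ← ENNReal.ofReal_mul (Real.exp_pos _).le, mul_inv_cancel₀ (Real.exp_pos _).ne',
        ENNReal.ofReal_one, one_mul]
    · rw [Set.indicator_of_notMem ht, cutInv, Set.indicator_of_notMem (fun h => ht (hiff.2 h))]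
      simp
  have hlim : ∀ b δ : ℝ, Tendsto (fun lam => ∫ x, rampInv b δ x ∂ρ lam) (𝓝[>] 0)
      (𝓝 (∫ x, rampInv b δ x ∂ρ₀)) := fun b δ =>
    tendsto_integral_of_tendsto_moments (hlpos.mono hfin) (hlpos.mono hsupp) hsupp₀ hmom
      (continuous_rampInv b δ)
  have hle : ρ₀ ≤ volume := Measure.restrict_le_self
  rw [Metric.tendsto_nhds]
  intro ε hε
  -- `cutInv` jumps at `e⁻¹`, so it is squeezed between continuous ramps. Each differs from it only
  -- on a strip of width `δ`, by at most `e`, which costs at most `eδ = ε/2`.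
  set δ : ℝ := ε / (2 * Real.exp 1) with hδ
  have hδ0 : 0 < δ := by positivity
  have hδε : Real.exp 1 * δ = ε / 2 := by rw [hδ]; field_simp
  have hup : ∫ x, rampInv (Real.exp (-1) - δ) δ x ∂ρ₀ ≤ 1 + ε / 2 := by
    have hi : Integrable ((Set.Ioc (Real.exp (-1) - δ) (Real.exp (-1))).indicator
        (fun _ => Real.exp 1)) ρ₀ := (integrable_const _).indicator measurableSet_Ioc
    calc _ ≤ ∫ x, (cutInv x + (Set.Ioc (Real.exp (-1) - δ) (Real.exp (-1))).indicator
            (fun _ => Real.exp 1) x) ∂ρ₀ :=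
          integral_mono (integrable_of_continuous_of_ae_mem_Icc hsupp₀ (continuous_rampInv _ _))
            ((integrable_cutInv ρ₀).add hi) fun x => rampInv_le_add hδ0 x
      _ = 1 + ∫ x, (Set.Ioc (Real.exp (-1) - δ) (Real.exp (-1))).indicator
            (fun _ => Real.exp 1) x ∂ρ₀ := by
          rw [integral_add (integrable_cutInv ρ₀) hi, integral_cutInv]
      _ ≤ 1 + Real.exp 1 * (Real.exp (-1) - (Real.exp (-1) - δ)) := by
          gcongr
          exact integral_indicator_Icc_le (by linarith) (Real.exp_pos _).le measurableSet_Ioc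
            Set.Ioc_subset_Icc_self _ hle
      _ = 1 + ε / 2 := by rw [← hδε]; ring
  have hdown : 1 - ε / 2 ≤ ∫ x, rampInv (Real.exp (-1)) δ x ∂ρ₀ := by
    have hi : Integrable ((Set.Icc (Real.exp (-1)) (Real.exp (-1) + δ)).indicator
        (fun _ => Real.exp 1)) ρ₀ := (integrable_const _).indicator measurableSet_Icc
    have hi' := integrable_of_continuous_of_ae_mem_Icc hsupp₀
      (continuous_rampInv (Real.exp (-1)) δ)
    have h1 : ∫ x, cutInv x ∂ρ₀ ≤ ∫ x, rampInv (Real.exp (-1)) δ x ∂ρ₀ +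
        ∫ x, (Set.Icc (Real.exp (-1)) (Real.exp (-1) + δ)).indicator
          (fun _ => Real.exp 1) x ∂ρ₀ := by
      rw [← integral_add hi' hi]
      exact integral_mono (integrable_cutInv ρ₀) (hi'.add hi) fun x => cutInv_le_add hδ0 x
    have h2 := integral_indicator_Icc_le (a := Real.exp (-1)) (b := Real.exp (-1) + δ)
      (by linarith) (Real.exp_pos 1).le measurableSet_Icc subset_rfl ρ₀ hle
    have h3 : Real.exp 1 * (Real.exp (-1) + δ - Real.exp (-1)) = ε / 2 := by
      rw [← hδε]; ring
    rw [integral_cutInv] at h1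
    linarith
  have e1 := (hlim (Real.exp (-1) - δ) δ).eventually_lt_const
    (show _ < 1 + ε by linarith)
  have e2 := (hlim (Real.exp (-1)) δ).eventually_const_lt
    (show 1 - ε < _ by linarith)
  filter_upwards [e1, e2, hlpos] with lam h1 h2 hl
  have := hfin lam hl
  rw [hcut lam hl, Real.dist_eq, abs_lt]
  have m1 := integral_mono (integrable_cutInv (ρ lam))
    (integrable_of_continuous_of_ae_mem_Icc (hsupp lam hl) (continuous_rampInv _ _))
    fun x => cutInv_le_rampInv hδ0 x
  have m2 := integral_mono
    (integrable_of_continuous_of_ae_mem_Icc (hsupp lam hl) (continuous_rampInv _ _))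
    (integrable_cutInv (ρ lam)) fun x => rampInv_le_cutInv hδ0 x
  constructor <;> linarith

/-! ### The Laplace exponent and the kernel -/

theorem one_sub_exp_le {lam τ : ℝ} (hτ : 0 < τ) :
    1 - Real.exp (-lam * τ) ≤ max 1 lam * min 1 τ := by
  have h1 : 1 - Real.exp (-lam * τ) ≤ 1 := by linarith [Real.exp_pos (-lam * τ)]
  have h2 : 1 - Real.exp (-lam * τ) ≤ lam * τ := by linarith [Real.add_one_le_exp (-lam * τ)]
  rcases le_total 1 τ with h | h
  · rw [min_eq_left h, mul_one]
    exact h1.trans (le_max_left _ _)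
  · rw [min_eq_right h]
    exact h2.trans (mul_le_mul_of_nonneg_right (le_max_right _ _) hτ.le)

theorem one_sub_exp_nonneg {lam τ : ℝ} (hlam : 0 < lam) (hτ : 0 < τ) :
    0 ≤ 1 - Real.exp (-lam * τ) := by
  have : Real.exp (-lam * τ) ≤ 1 := Real.exp_le_one_iff.2 (by nlinarith)
  linarith

theorem IsLevyMeasure.integrable_min {σ : Measure ℝ} (hσ : IsLevyMeasure σ) :
    IntegrableOn (fun τ => min 1 τ) (Set.Ioi 0) σ := by
  refine ⟨by fun_prop, ?_⟩
  rw [hasFiniteIntegral_iff_ofReal]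
  · exact hσ.lintegral_min_lt_top
  · filter_upwards [ae_restrict_mem measurableSet_Ioi] with τ hτ
    exact le_min zero_le_one (le_of_lt hτ)

theorem IsLevyMeasure.integrable_one_sub_exp {σ : Measure ℝ} (hσ : IsLevyMeasure σ) {lam : ℝ}
    (hlam : 0 < lam) : IntegrableOn (fun τ => 1 - Real.exp (-lam * τ)) (Set.Ioi 0) σ := by
  refine (hσ.integrable_min.const_mul (max 1 lam)).mono' (by fun_prop) ?_
  filter_upwards [ae_restrict_mem measurableSet_Ioi] with τ hτ
  rw [Real.norm_eq_abs, abs_of_nonneg (one_sub_exp_nonneg hlam hτ)]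
  exact one_sub_exp_le hτ

theorem IsLevyMeasure.laplaceExponent_pos {σ : Measure ℝ} (hσ : IsLevyMeasure σ) {lam : ℝ}
    (hlam : 0 < lam) : 0 < laplaceExponent σ lam := by
  have hnn : 0 ≤ᵐ[σ.restrict (Set.Ioi 0)] fun τ => 1 - Real.exp (-lam * τ) := by
    filter_upwards [ae_restrict_mem measurableSet_Ioi] with τ hτ
    exact one_sub_exp_nonneg hlam hτ
  rw [laplaceExponent, integral_pos_iff_support_of_nonneg_ae hnn
    (hσ.integrable_one_sub_exp hlam)]
  have hsub : Set.Ioi (0 : ℝ) ⊆ Function.support fun τ => 1 - Real.exp (-lam * τ) := by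
    intro τ hτ
    have hτ : 0 < τ := hτ
    have : Real.exp (-lam * τ) < 1 := by
      rw [← Real.exp_zero]
      exact Real.exp_lt_exp.2 (by nlinarith)
    exact (sub_pos.2 this).ne'
  refine lt_of_lt_of_le ?_ (measure_mono hsub)
  rw [Measure.restrict_apply_self, hσ.infinite]
  exact ENNReal.zero_lt_top

theorem integral_const_mul_exp_neg (lam τ : ℝ) :
    ∫ t in (0 : ℝ)..τ, lam * Real.exp (-lam * t) = 1 - Real.exp (-lam * τ) := by
  have hderiv : ∀ t ∈ Set.uIcc 0 τ,
      HasDerivAt (fun t => -Real.exp (-lam * t)) (lam * Real.exp (-lam * t)) t := by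
    intro t _
    have hlin : HasDerivAt (fun t => -lam * t) (-lam) t := by
      simpa using (hasDerivAt_id t).const_mul (-lam)
    exact hlin.exp.neg.congr_deriv (by ring)
  rw [intervalIntegral.integral_eq_sub_of_hasDerivAt hderiv
    (Continuous.intervalIntegrable (by fun_prop) _ _)]
  simp
  ring

/-- Layer-cake formula: since `1 - e^{-λτ} = ∫_0^τ λ e^{-λt} dt`, integrating against `σ` yields
`Φ(λ) = λ ∫ e^{-λt} σ((t, ∞)) dt`. -/
theorem IsLevyMeasure.laplace_tail {σ : Measure ℝ} (hσ : IsLevyMeasure σ) {lam : ℝ}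
    (hlam : 0 < lam) :
    laplace (fun t => σ (Set.Ioi t)) lam = ENNReal.ofReal (laplaceExponent σ lam / lam) := by
  have hcake := lintegral_comp_eq_lintegral_meas_lt_mul (f := id)
    (g := fun t => lam * Real.exp (-lam * t)) (σ.restrict (Set.Ioi 0))
    (by filter_upwards [ae_restrict_mem measurableSet_Ioi] with τ hτ using le_of_lt hτ)
    aemeasurable_id (fun t _ => Continuous.intervalIntegrable (by fun_prop) _ _)
    (Eventually.of_forall fun t => by positivity)
  simp only [id, integral_const_mul_exp_neg] at hcake
  have hΦ : ENNReal.ofReal (laplaceExponent σ lam) =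
      ∫⁻ τ in Set.Ioi 0, ENNReal.ofReal (1 - Real.exp (-lam * τ)) ∂σ := by
    rw [laplaceExponent, ofReal_integral_eq_lintegral_ofReal (hσ.integrable_one_sub_exp hlam)]
    filter_upwards [ae_restrict_mem measurableSet_Ioi] with τ hτ
    exact one_sub_exp_nonneg hlam hτ
  rw [ENNReal.ofReal_div_of_pos hlam, hΦ, hcake, ENNReal.eq_div_iff
    (by simpa using hlam) ENNReal.ofReal_ne_top, laplace,
    ← lintegral_const_mul' _ _ ENNReal.ofReal_ne_top]
  refine setLIntegral_congr_fun measurableSet_Ioi fun t ht => ?_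
  have ht : 0 < t := ht
  have hset : (σ.restrict (Set.Ioi 0)) {a | t < a} = σ (Set.Ioi t) := by
    change (σ.restrict (Set.Ioi 0)) (Set.Ioi t) = _
    rw [Measure.restrict_apply measurableSet_Ioi, Set.inter_eq_left.2]
    exact Set.Ioi_subset_Ioi ht.le
  rw [hset, ENNReal.ofReal_mul hlam.le]
  ring

theorem measurable_tail (σ : Measure ℝ) : Measurable fun t => σ (Set.Ioi t) :=
  Antitone.measurable fun _ _ h => measure_mono (Set.Ioi_subset_Ioi h)

theorem IsLevyMeasure.tail_lt_top {σ : Measure ℝ} (hσ : IsLevyMeasure σ) {t : ℝ} (ht : 0 < t) :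
    σ (Set.Ioi t) < ∞ := by
  have h := (hσ.integrable_min).measure_ge_lt_top (ε := min 1 t) (lt_min one_pos ht)
  refine lt_of_le_of_lt ?_ h
  rw [Measure.restrict_apply (measurableSet_le measurable_const (by fun_prop))]
  refine measure_mono fun τ hτ => ⟨?_, ht.trans hτ⟩
  exact min_le_min_left 1 (le_of_lt (show t < τ from hτ))

theorem IsLevyMeasure.kernelLaplace_eq {σ : Measure ℝ} (hσ : IsLevyMeasure σ) {lam : ℝ}
    (hlam : 0 < lam) : kernelLaplace σ lam = laplaceExponent σ lam / lam := by
  have hm : Measurable (kernel σ) := (measurable_tail σ).ennreal_toReal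
  have hnn : 0 ≤ᵐ[volume.restrict (Set.Ioi (0 : ℝ))]
      fun t => Real.exp (-lam * t) * kernel σ t :=
    Eventually.of_forall fun t => mul_nonneg (Real.exp_pos _).le measureReal_nonneg
  rw [kernelLaplace, integral_eq_lintegral_of_nonneg_ae hnn (by fun_prop)]
  have : ∫⁻ t in Set.Ioi (0 : ℝ), ENNReal.ofReal (Real.exp (-lam * t) * kernel σ t) =
      laplace (fun t => σ (Set.Ioi t)) lam := by
    refine setLIntegral_congr_fun measurableSet_Ioi fun t ht => ?_
    simp only
    rw [ENNReal.ofReal_mul (Real.exp_pos _).le, kernel, Measure.real,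
      ENNReal.ofReal_toReal (hσ.tail_lt_top ht).ne]
  rw [this, hσ.laplace_tail hlam, ENNReal.toReal_ofReal
    (div_nonneg (hσ.laplaceExponent_pos hlam).le hlam.le)]

/-! ### Laplace transforms of convolutions -/

/-- Both `F` and its shift by `s ≥ 0` vanish on `(-∞, 0]`, so the integrals extend to the whole
line, where Lebesgue measure is translation invariant. -/
theorem laplace_comp_sub {F : ℝ → ℝ≥0∞} (hF : ∀ t ≤ 0, F t = 0) (lam : ℝ) {s : ℝ} (hs : 0 ≤ s) :
    laplace (fun t => F (t - s)) lam = ENNReal.ofReal (Real.exp (-lam * s)) * laplace F lam := by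
  have hfull : ∀ G : ℝ → ℝ≥0∞, (∀ t ≤ 0, G t = 0) →
      laplace G lam = ∫⁻ t, ENNReal.ofReal (Real.exp (-lam * t)) * G t := by
    intro G hG
    rw [laplace, ← lintegral_indicator measurableSet_Ioi]
    refine lintegral_congr fun t => ?_
    by_cases ht : 0 < t
    · rw [Set.indicator_of_mem (show t ∈ Set.Ioi 0 from ht)]
    · rw [Set.indicator_of_notMem (by simpa using ht), hG t (not_lt.1 ht), mul_zero]
  rw [hfull _ fun t ht => hF _ (by linarith), hfull _ hF,
    ← lintegral_const_mul' _ _ ENNReal.ofReal_ne_top,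
    ← lintegral_sub_right_eq_self (fun t => ENNReal.ofReal (Real.exp (-lam * s)) *
      (ENNReal.ofReal (Real.exp (-lam * t)) * F t)) s]
  refine lintegral_congr fun t => ?_
  rw [← mul_assoc, ← ENNReal.ofReal_mul (Real.exp_pos _).le, ← Real.exp_add]
  congr 3
  ring

theorem laplace_lintegral {α : Type*} [MeasurableSpace α] (μ : Measure α) [SFinite μ]
    {F : ℝ → α → ℝ≥0∞} (hF : Measurable (Function.uncurry F)) (lam : ℝ) :
    laplace (fun t => ∫⁻ a, F t a ∂μ) lam = ∫⁻ a, laplace (fun t => F t a) lam ∂μ := by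
  unfold laplace
  rw [lintegral_lintegral_swap (by fun_prop)]
  exact lintegral_congr fun t => (lintegral_const_mul' _ _ ENNReal.ofReal_ne_top).symm

theorem laplace_convolution {F : ℝ → ℝ≥0∞} (hFm : Measurable F) (hF : ∀ t ≤ 0, F t = 0)
    (μ : Measure ℝ) [SFinite μ] (hμ : ∀ᵐ s ∂μ, 0 ≤ s) (lam : ℝ) :
    laplace (fun t => ∫⁻ s, F (t - s) ∂μ) lam =
      laplace F lam * ∫⁻ s, ENNReal.ofReal (Real.exp (-lam * s)) ∂μ := by
  rw [laplace_lintegral μ (F := fun t s => F (t - s)) (by fun_prop), mul_comm,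
    ← lintegral_mul_const _ (by fun_prop)]
  refine lintegral_congr_ae (hμ.mono fun s hs => ?_)
  exact laplace_comp_sub hF lam hs

theorem lintegral_exp_neg_Ioi {a : ℝ} (ha : 0 < a) (r : ℝ) :
    ∫⁻ t in Set.Ioi r, ENNReal.ofReal (Real.exp (-t * a)) =
      ENNReal.ofReal (Real.exp (-r * a) / a) := by
  have hi : IntegrableOn (fun t => Real.exp (-a * t)) (Set.Ioi r) :=
    exp_neg_integrableOn_Ioi r ha
  have h1 := integral_exp_mul_Ioi (neg_lt_zero.2 ha) r
  have hc : ∀ t : ℝ, -t * a = -a * t := fun t => by ring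
  simp_rw [hc]
  rw [← ofReal_integral_eq_lintegral_ofReal hi
    (Eventually.of_forall fun t => (Real.exp_pos _).le), h1, neg_div_neg_eq]

/-! ### The laws of the subordinator -/

section Subordinator

variable {Ω : Type*} [MeasurableSpace Ω] {P : Measure Ω} {σ : Measure ℝ}
  {S : ℝ≥0 → Ω → ℝ}

theorem IsSubordinator.ae_nonneg (hS : IsSubordinator S σ P) : ∀ᵐ ω ∂P, ∀ t, 0 ≤ S t ω := by
  filter_upwards [hS.zero, hS.monotone] with ω h0 hm t
  exact h0 ▸ hm zero_le

variable [IsProbabilityMeasure P]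

/-- Monotone paths make `r ↦ P(S(r) < t)` antitone, hence measurable, and the rays `(-∞, t)` form a
generating π-system. This joint measurability is what Tonelli's theorem needs below. -/
theorem IsSubordinator.measurable_law (hS : IsSubordinator S σ P) :
    Measurable fun r : ℝ => P.map (S r.toNNReal) := by
  have : ∀ r : ℝ, IsProbabilityMeasure (P.map (S r.toNNReal)) := fun r =>
    Measure.isProbabilityMeasure_map (hS.measurable _).aemeasurable
  refine Measurable.measure_of_isPiSystem_of_isProbabilityMeasure
    ((borel_eq_generateFrom_Iio ℝ).symm ▸ BorelSpace.measurable_eq) isPiSystem_Iio ?_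
  rintro _ ⟨t, rfl⟩
  refine Antitone.measurable fun a b hab => ?_
  rw [Measure.map_apply (hS.measurable _) measurableSet_Iio,
    Measure.map_apply (hS.measurable _) measurableSet_Iio]
  refine measure_mono_ae (hS.monotone.mono fun ω hω h => ?_)
  exact lt_of_le_of_lt (hω (Real.toNNReal_le_toNNReal hab)) h

/-- The laws of a subordinator, as a kernel. -/
noncomputable def lawKernel (hS : IsSubordinator S σ P) : Kernel ℝ ℝ :=
  ⟨fun r => P.map (S r.toNNReal), hS.measurable_law⟩

theorem lawKernel_apply (hS : IsSubordinator S σ P) (r : ℝ) :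
    lawKernel hS r = P.map (S r.toNNReal) := rfl

instance (hS : IsSubordinator S σ P) : IsMarkovKernel (lawKernel hS) :=
  ⟨fun r => by
    rw [lawKernel_apply]
    exact Measure.isProbabilityMeasure_map (hS.measurable _).aemeasurable⟩

theorem ae_nonneg_lawKernel (hS : IsSubordinator S σ P) (r : ℝ) :
    ∀ᵐ s ∂lawKernel hS r, 0 ≤ s :=
  (ae_map_iff (hS.measurable _).aemeasurable measurableSet_Ici).2
    (hS.ae_nonneg.mono fun _ h => h _)

theorem lintegral_exp_lawKernel (hS : IsSubordinator S σ P) {r lam : ℝ} (hr : 0 ≤ r)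
    (hlam : 0 ≤ lam) :
    ∫⁻ s, ENNReal.ofReal (Real.exp (-lam * s)) ∂lawKernel hS r =
      ENNReal.ofReal (Real.exp (-r * laplaceExponent σ lam)) := by
  have h := hS.laplace r.toNNReal lam hlam
  rw [Real.coe_toNNReal r hr] at h
  rw [lawKernel_apply, lintegral_map (by fun_prop) (hS.measurable _), ← h,
    ofReal_integral_eq_lintegral_ofReal _ (Eventually.of_forall fun _ => (Real.exp_pos _).le)]
  have hm := hS.measurable r.toNNReal
  refine Integrable.of_bound (by fun_prop) 1 (hS.ae_nonneg.mono fun ω hω => ?_)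
  rw [Real.norm_eq_abs, Real.abs_exp, Real.exp_le_one_iff]
  have := mul_nonneg hlam (hω r.toNNReal)
  linarith

theorem laplace_Ioi_indicator {lam : ℝ} (hlam : 0 < lam) :
    laplace ((Set.Ioi 0).indicator 1) lam = ENNReal.ofReal lam⁻¹ := by
  have h := lintegral_exp_neg_Ioi hlam 0
  simp only [neg_zero, zero_mul, Real.exp_zero, one_div] at h
  rw [← h]
  refine setLIntegral_congr_fun measurableSet_Ioi fun t ht => ?_
  rw [Set.indicator_of_mem ht, Pi.one_apply, mul_one]
  congr 2
  ring

/-- The distribution function is a convolution with the Heaviside function, so that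
`laplace_convolution` applies to it. -/
theorem lawKernel_Iio (hS : IsSubordinator S σ P) (r t : ℝ) :
    lawKernel hS r (Set.Iio t) = ∫⁻ s, (Set.Ioi 0).indicator 1 (t - s) ∂lawKernel hS r := by
  rw [← lintegral_indicator_one measurableSet_Iio]
  refine lintegral_congr fun s => ?_
  simp [Set.indicator]

theorem laplace_lawKernel_Iio (hS : IsSubordinator S σ P) {r lam : ℝ} (hr : 0 ≤ r)
    (hlam : 0 < lam) :
    laplace (fun t => lawKernel hS r (Set.Iio t)) lam =
      ENNReal.ofReal (lam⁻¹ * Real.exp (-r * laplaceExponent σ lam)) := by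
  simp_rw [lawKernel_Iio]
  rw [laplace_convolution (measurable_one.indicator measurableSet_Ioi) (by simp)
    _ (ae_nonneg_lawKernel hS r), laplace_Ioi_indicator hlam,
    lintegral_exp_lawKernel hS hr hlam.le, ENNReal.ofReal_mul (inv_nonneg.2 hlam.le)]

/-! ### The density of the inverse process -/

/-- The tail of the Lévy measure, extended by zero. -/
noncomputable def tail (σ : Measure ℝ) : ℝ → ℝ≥0∞ :=
  (Set.Ioi 0).indicator fun t => σ (Set.Ioi t)

theorem measurable_tail_indicator (σ : Measure ℝ) : Measurable (tail σ) :=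
  (measurable_tail σ).indicator measurableSet_Ioi

theorem laplace_tail_indicator (hσ : IsLevyMeasure σ) {lam : ℝ} (hlam : 0 < lam) :
    laplace (tail σ) lam = ENNReal.ofReal (laplaceExponent σ lam / lam) := by
  rw [← hσ.laplace_tail hlam]
  refine setLIntegral_congr_fun measurableSet_Ioi fun t ht => ?_
  simp only [tail]
  rw [Set.indicator_of_mem ht]

/-- The density `∫ k(t - s) P(S(r) ∈ ds)` at `r` of the inverse process at time `t`. -/
noncomputable def inverseLaw (hS : IsSubordinator S σ P) (t r : ℝ) : ℝ≥0∞ :=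
  ∫⁻ s, tail σ (t - s) ∂lawKernel hS r

theorem measurable_inverseLaw (hS : IsSubordinator S σ P) :
    Measurable (Function.uncurry (inverseLaw hS)) := by
  have hm : Measurable fun p : (ℝ × ℝ) × ℝ => tail σ (p.1.1 - p.2) :=
    (measurable_tail_indicator σ).comp (by fun_prop)
  exact Measurable.lintegral_kernel_prod_right
    (κ := (lawKernel hS).comap Prod.snd measurable_snd)
    (f := fun p s => tail σ (p.1 - s)) hm

theorem laplace_inverseLaw (hσ : IsLevyMeasure σ) (hS : IsSubordinator S σ P) {r lam : ℝ}
    (hr : 0 ≤ r) (hlam : 0 < lam) :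
    laplace (fun t => inverseLaw hS t r) lam =
      ENNReal.ofReal (laplaceExponent σ lam / lam * Real.exp (-r * laplaceExponent σ lam)) := by
  unfold inverseLaw
  rw [laplace_convolution (measurable_tail_indicator σ)
    (fun t ht => Set.indicator_of_notMem (by simpa using ht) _) _ (ae_nonneg_lawKernel hS r),
    laplace_tail_indicator hσ hlam, lintegral_exp_lawKernel hS hr hlam.le,
    ENNReal.ofReal_mul (div_nonneg (hσ.laplaceExponent_pos hlam).le hlam.le)]

/-- Integrating `(Φ/λ) e^{-qΦ}` over `q > r` gives `e^{-rΦ}/λ`, which is also the transform of `t ↦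
P(S(r) < t)`. Uniqueness then identifies the two functions of `t`. -/
theorem laplace_lintegral_inverseLaw (hσ : IsLevyMeasure σ) (hS : IsSubordinator S σ P)
    {r lam : ℝ} (hr : 0 ≤ r) (hlam : 0 < lam) :
    laplace (fun t => ∫⁻ q in Set.Ioi r, inverseLaw hS t q) lam =
      ENNReal.ofReal (lam⁻¹ * Real.exp (-r * laplaceExponent σ lam)) := by
  have hΦ := hσ.laplaceExponent_pos hlam
  have hc : 0 ≤ laplaceExponent σ lam / lam := div_nonneg hΦ.le hlam.le
  rw [laplace_lintegral _ (measurable_inverseLaw hS)]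
  calc _ = ∫⁻ q in Set.Ioi r, ENNReal.ofReal (laplaceExponent σ lam / lam) *
          ENNReal.ofReal (Real.exp (-q * laplaceExponent σ lam)) := by
        refine setLIntegral_congr_fun measurableSet_Ioi fun q hq => ?_
        rw [laplace_inverseLaw hσ hS (hr.trans (le_of_lt hq)) hlam, ENNReal.ofReal_mul hc]
    _ = _ := by
        rw [lintegral_const_mul' _ _ ENNReal.ofReal_ne_top, lintegral_exp_neg_Ioi hΦ,
          ← ENNReal.ofReal_mul hc]
        congr 1
        field_simp

theorem ae_lintegral_inverseLaw (hσ : IsLevyMeasure σ) (hS : IsSubordinator S σ P) {r : ℝ}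
    (hr : 0 ≤ r) :
    ∀ᵐ t ∂volume.restrict (Set.Ioi (0 : ℝ)),
      ∫⁻ q in Set.Ioi r, inverseLaw hS t q = lawKernel hS r (Set.Iio t) := by
  refine ae_eq_of_laplace_eq (measurable_inverseLaw hS).lintegral_prod_right'
    (Monotone.measurable fun a b h => measure_mono (Set.Iio_subset_Iio h)) ?_ ?_
  · intro lam hlam
    rw [laplace_lintegral_inverseLaw hσ hS hr hlam]
    exact ENNReal.ofReal_ne_top
  · intro lam hlam
    rw [laplace_lintegral_inverseLaw hσ hS hr hlam, laplace_lawKernel_Iio hS hr hlam]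

/-! ### The law of the inverse process -/

/-- Markov's inequality for `e^{-S(n)}` bounds `P(S(n) < t)` by `e^t e^{-nΦ(1)}`, which tends to
`0`. This rules out the empty set in the definition of `E(t)`, whose infimum in `ℝ≥0` would be `0`.
-/
theorem IsSubordinator.ae_unbounded (hσ : IsLevyMeasure σ) (hS : IsSubordinator S σ P) (t : ℝ) :
    ∀ᵐ ω ∂P, ∃ r, t ≤ S r ω := by
  set φ := laplaceExponent σ 1 with hφ
  have hφ0 : 0 < φ := hσ.laplaceExponent_pos one_pos
  have hbound : ∀ n : ℕ, P {ω | ∀ r, S r ω < t} ≤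
      ENNReal.ofReal (Real.exp t * Real.exp (-n * φ)) := by
    intro n
    have hm := hS.measurable n
    have h1 := hS.laplace n 1 zero_le_one
    have hi : Integrable (fun ω => Real.exp (-1 * S n ω)) P := by
      refine Integrable.of_bound (by fun_prop) 1 (hS.ae_nonneg.mono fun ω hω => ?_)
      rw [Real.norm_eq_abs, Real.abs_exp, Real.exp_le_one_iff]
      linarith [hω n]
    have h2 := mul_meas_ge_le_integral_of_nonneg
      (Eventually.of_forall fun ω => (Real.exp_pos (-1 * S n ω)).le) hi (Real.exp (-t))
    rw [h1] at h2
    have h3 : P.real {ω | Real.exp (-t) ≤ Real.exp (-1 * S n ω)} ≤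
        Real.exp t * Real.exp (-n * φ) := by
      have := mul_le_mul_of_nonneg_left h2 (Real.exp_pos t).le
      rw [← mul_assoc, ← Real.exp_add, add_neg_cancel, Real.exp_zero, one_mul] at this
      simpa using this
    calc P {ω | ∀ r, S r ω < t} ≤ P {ω | Real.exp (-t) ≤ Real.exp (-1 * S n ω)} := by
          refine measure_mono fun ω hω => ?_
          have := hω n
          simp only [Set.mem_ofPred_eq, Real.exp_le_exp]
          linarith
      _ = ENNReal.ofReal (P.real {ω | Real.exp (-t) ≤ Real.exp (-1 * S n ω)}) := by
          rw [ofReal_measureReal]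
      _ ≤ _ := ENNReal.ofReal_le_ofReal h3
  have hlim : Tendsto (fun n : ℕ => ENNReal.ofReal (Real.exp t * Real.exp (-n * φ))) atTop
      (𝓝 0) := by
    rw [← ENNReal.ofReal_zero]
    refine (ENNReal.continuous_ofReal.tendsto 0).comp ?_
    rw [← mul_zero (Real.exp t)]
    refine Tendsto.const_mul _ (Real.tendsto_exp_atBot.comp ?_)
    simp_rw [neg_mul]
    exact tendsto_neg_atTop_atBot.comp (tendsto_natCast_atTop_atTop.atTop_mul_const hφ0)
  have hz : P {ω | ∀ r, S r ω < t} = 0 :=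
    le_antisymm (ge_of_tendsto' hlim hbound) zero_le
  refine (measure_eq_zero_iff_ae_notMem.1 hz).mono fun ω hω => ?_
  simpa using hω

/-- If `S(a) < t`, right continuity gives some `q > a` with `S(q) < t`, and by monotonicity the
infimum is at least `q`. This makes the inequality strict. -/
theorem lt_inverseProcess_iff {Ω : Type*} {S : ℝ≥0 → Ω → ℝ} {t : ℝ} {ω : Ω} (hm : Monotone fun r => S r ω)
    (hc : ∀ r, ContinuousWithinAt (fun q => S q ω) (Set.Ici r) r) (hu : ∃ r, t ≤ S r ω)
    {a : ℝ} (ha : 0 ≤ a) : a < inverseProcess S t ω ↔ S a.toNNReal ω < t := by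
  rw [inverseProcess, ← Real.toNNReal_lt_iff_lt_coe ha]
  constructor
  · intro h
    by_contra hn
    exact absurd (csInf_le (OrderBot.bddBelow _)
      (show a.toNNReal ∈ {r | t ≤ S r ω} from not_lt.1 hn)) (not_le.2 h)
  · intro h
    have he : ∀ᶠ q in 𝓝[>] a.toNNReal, S q ω < t :=
      ((hc a.toNNReal).mono Set.Ioi_subset_Ici_self).eventually_lt_const h
    obtain ⟨q, hq, hq'⟩ := (he.and eventually_mem_nhdsWithin).exists
    refine lt_of_lt_of_le hq' (le_csInf hu fun r hr => ?_)
    by_contra hn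
    exact absurd (hr.trans (hm (not_le.1 hn).le)) (not_le.2 hq)

theorem ae_lt_inverseProcess_iff (hσ : IsLevyMeasure σ) (hS : IsSubordinator S σ P) (t : ℝ) :
    ∀ᵐ ω ∂P, ∀ a : ℝ, 0 ≤ a → (a < inverseProcess S t ω ↔ S a.toNNReal ω < t) := by
  filter_upwards [hS.monotone, hS.rightContinuous, hS.ae_unbounded hσ t] with ω h1 h2 h3 a ha
  exact lt_inverseProcess_iff h1 h2 h3 ha

theorem aemeasurable_inverseProcess (hσ : IsLevyMeasure σ) (hS : IsSubordinator S σ P) (t : ℝ) :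
    AEMeasurable (inverseProcess S t) P := by
  -- The path properties hold only almost surely and the bad set need not be measurable, so it is
  -- enlarged to a measurable null set `G`, on which `E(t)` is replaced by `0`.
  obtain ⟨G, hGsub, hGm, hG0⟩ := exists_measurable_superset_of_null
    (ae_iff.1 (ae_lt_inverseProcess_iff hσ hS t))
  have hgood : ∀ ω ∈ Gᶜ, ∀ a : ℝ, 0 ≤ a →
      (a < inverseProcess S t ω ↔ S a.toNNReal ω < t) := fun ω hω => by
    by_contra h
    exact hω (hGsub h)
  refine ⟨Gᶜ.indicator (inverseProcess S t), measurable_of_Ioi fun a => ?_, ?_⟩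
  · rcases lt_or_ge a 0 with ha | ha
    · convert MeasurableSet.univ
      refine Set.eq_univ_of_forall fun ω => ha.trans_le ?_
      exact Set.indicator_nonneg (fun _ _ => NNReal.coe_nonneg _) ω
    · have : Gᶜ.indicator (inverseProcess S t) ⁻¹' Set.Ioi a =
          Gᶜ ∩ {ω | S a.toNNReal ω < t} := by
        ext ω
        by_cases hω : ω ∈ Gᶜ
        · simp only [Set.mem_preimage, Set.indicator_of_mem hω, Set.mem_Ioi, Set.mem_inter_iff,
            hω, true_and, Set.mem_ofPred_eq]
          exact hgood ω hω a ha
        · simp only [Set.mem_preimage, Set.indicator_of_notMem hω, Set.mem_Ioi,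
            Set.mem_inter_iff, hω, false_and, iff_false, not_lt]
          exact ha
      rw [this]
      exact hGm.compl.inter (measurableSet_lt (hS.measurable _) measurable_const)
  · filter_upwards [measure_eq_zero_iff_ae_notMem.1 hG0] with ω hω
    rw [Set.indicator_of_mem (show ω ∈ Gᶜ from hω)]

theorem map_inverseProcess_Ioi (hσ : IsLevyMeasure σ) (hS : IsSubordinator S σ P) (t : ℝ) {a : ℝ}
    (ha : 0 ≤ a) :
    P.map (inverseProcess S t) (Set.Ioi a) = lawKernel hS a (Set.Iio t) := by
  rw [Measure.map_apply_of_aemeasurable (aemeasurable_inverseProcess hσ hS t) measurableSet_Ioi,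
    lawKernel_apply, Measure.map_apply (hS.measurable _) measurableSet_Iio]
  refine measure_congr ?_
  filter_upwards [ae_lt_inverseProcess_iff hσ hS t] with ω hω
  exact propext (hω a ha)

theorem map_inverseProcess_Ioi_of_nonpos (hσ : IsLevyMeasure σ) (hS : IsSubordinator S σ P)
    {t : ℝ} (ht : 0 < t) {a : ℝ} (ha : a ≤ 0) :
    P.map (inverseProcess S t) (Set.Ioi a) = 1 := by
  have := Measure.isProbabilityMeasure_map (aemeasurable_inverseProcess hσ hS t)
  refine le_antisymm prob_le_one ?_
  refine le_trans ?_ (measure_mono (Set.Ioi_subset_Ioi ha))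
  rw [map_inverseProcess_Ioi hσ hS t le_rfl, lawKernel_apply,
    Measure.map_apply (hS.measurable _) measurableSet_Iio, ← measure_univ (μ := P)]
  refine measure_mono_ae (hS.zero.mono fun ω hω _ => ?_)
  change S (Real.toNNReal 0) ω < t
  rw [Real.toNNReal_zero, hω]
  exact ht

/-- For almost every `t`, the law of the inverse process at time `t` has density
`inverseLaw hS t`. -/
theorem ae_map_inverseProcess (hσ : IsLevyMeasure σ) (hS : IsSubordinator S σ P) :
    ∀ᵐ t ∂volume.restrict (Set.Ioi (0 : ℝ)), P.map (inverseProcess S t) =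
      volume.withDensity ((Set.Ioi 0).indicator (inverseLaw hS t)) := by
  -- The exceptional null set depends on the endpoint; rational endpoints give a single null set,
  -- and rational rays still generate the Borel sets.
  have h : ∀ᵐ t ∂volume.restrict (Set.Ioi (0 : ℝ)), ∀ q : ℚ, (0 : ℝ) ≤ q →
      ∫⁻ r in Set.Ioi (q : ℝ), inverseLaw hS t r = lawKernel hS q (Set.Iio t) := by
    rw [ae_all_iff]
    intro q
    by_cases hq : (0 : ℝ) ≤ q
    · exact (ae_lintegral_inverseLaw hσ hS hq).mono fun t ht _ => ht
    · exact Eventually.of_forall fun t h => absurd h hq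
  filter_upwards [h, ae_restrict_mem measurableSet_Ioi] with t ht ht0
  have hprob := Measure.isProbabilityMeasure_map (aemeasurable_inverseProcess hσ hS t)
  refine Measure.ext_of_generateFrom_of_iUnion (⋃ a : ℚ, {Set.Ioi (a : ℝ)})
    (fun n : ℕ => Set.Ioi (-(n : ℝ)))
    (Real.borel_eq_generateFrom_Ioi_rat ▸ BorelSpace.measurable_eq)
    Real.isPiSystem_Ioi_rat ?_ ?_ (fun n => measure_ne_top _ _) ?_
  · refine Set.eq_univ_of_forall fun x => Set.mem_iUnion.2 ?_
    obtain ⟨n, hn⟩ := exists_nat_gt (-x)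
    exact ⟨n, by simp only [Set.mem_Ioi]; linarith⟩
  · intro n
    exact Set.mem_iUnion.2 ⟨-(n : ℚ), by simp⟩
  · intro s hs
    obtain ⟨q, hq⟩ := Set.mem_iUnion.1 hs
    rw [Set.mem_singleton_iff.1 hq, withDensity_apply _ measurableSet_Ioi,
      setLIntegral_indicator measurableSet_Ioi, Set.Ioi_inter_Ioi]
    rcases le_total 0 (q : ℝ) with h0 | h0
    · rw [max_eq_right h0, ht q h0, map_inverseProcess_Ioi hσ hS t h0]
    -- For `q ≤ 0` both sides have full mass, because `E(t) > 0` almost surely when `t > 0`.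
    · have := ht 0 (by simp)
      rw [max_eq_left h0, map_inverseProcess_Ioi_of_nonpos hσ hS ht0 h0]
      rw [Rat.cast_zero] at this
      rw [this, ← map_inverseProcess_Ioi hσ hS t le_rfl,
        map_inverseProcess_Ioi_of_nonpos hσ hS ht0 le_rfl]

theorem ae_inverseDensity (hσ : IsLevyMeasure σ) (hS : IsSubordinator S σ P) :
    ∀ᵐ t ∂volume.restrict (Set.Ioi (0 : ℝ)), ∀ᵐ τ ∂volume.restrict (Set.Ioi (0 : ℝ)),
      inverseLaw hS t τ ≠ ∞ ∧ inverseDensity S P t τ = (inverseLaw hS t τ).toReal := by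
  filter_upwards [ae_map_inverseProcess hσ hS] with t ht
  have hprob := Measure.isProbabilityMeasure_map (aemeasurable_inverseProcess hσ hS t)
  have hm : Measurable (inverseLaw hS t) := (measurable_inverseLaw hS).of_uncurry_left
  have hmi := hm.indicator (measurableSet_Ioi (a := (0 : ℝ)))
  have hfin : ∀ᵐ τ, (Set.Ioi (0 : ℝ)).indicator (inverseLaw hS t) τ < ∞ := by
    refine ae_lt_top hmi ?_
    rw [← setLIntegral_univ, ← withDensity_apply _ MeasurableSet.univ, ← ht]
    exact measure_ne_top _ _
  have hd := Measure.rnDeriv_withDensity volume hmi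
  rw [← ht] at hd
  rw [ae_restrict_iff' measurableSet_Ioi]
  filter_upwards [hfin, hd] with τ h1 h2 hτ
  rw [Set.indicator_of_mem hτ] at h1 h2
  refine ⟨h1.ne, ?_⟩
  rw [inverseDensity, pdf, h2]

end Subordinator

section Resolvent

/-! ### The resolvent of the heat kernel -/

/-- The Green function `∫_0^∞ e^{-τ φ} v(x, τ) dτ`. -/
noncomputable def resolvent {d : ℕ} (x : EuclideanSpace ℝ (Fin d)) (φ : ℝ) : ℝ :=
  ∫ τ in Set.Ioi (0 : ℝ), Real.exp (-τ * φ) * heatKernel x τ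

variable {d : ℕ} {x : EuclideanSpace ℝ (Fin d)}

theorem heatKernel_eq (x : EuclideanSpace ℝ (Fin d)) {τ : ℝ} (hτ : 0 < τ) :
    heatKernel x τ = (2 * Real.pi) ^ (-((d : ℝ) / 2)) *
      (τ ^ (-((d : ℝ) / 2)) * Real.exp (-(‖x‖ ^ 2 / 2 * τ⁻¹))) := by
  rw [heatKernel, Real.mul_rpow (by positivity) hτ.le, Real.rpow_neg (by positivity),
    Real.rpow_neg hτ.le, one_div, mul_inv, mul_assoc]
  congr 4
  field_simp

theorem heatKernel_pos (x : EuclideanSpace ℝ (Fin d)) {τ : ℝ} (hτ : 0 < τ) :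
    0 < heatKernel x τ := by
  unfold heatKernel
  positivity

theorem measurable_heatKernel (x : EuclideanSpace ℝ (Fin d)) : Measurable (heatKernel x) := by
  unfold heatKernel
  fun_prop

theorem resolvent_pos {φ : ℝ}
    (hi : IntegrableOn (fun τ => Real.exp (-τ * φ) * heatKernel x τ) (Set.Ioi 0)) :
    0 < resolvent x φ := by
  rw [resolvent, setIntegral_pos_iff_support_of_nonneg_ae _ hi]
  · have : Set.Ioi (0 : ℝ) ⊆
        Function.support fun τ => Real.exp (-τ * φ) * heatKernel x τ := fun τ hτ =>
      (mul_pos (Real.exp_pos _) (heatKernel_pos x hτ)).ne'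
    rw [Set.inter_eq_right.2 this]
    simp
  · filter_upwards [ae_restrict_mem measurableSet_Ioi] with τ hτ
    exact (mul_pos (Real.exp_pos _) (heatKernel_pos x hτ)).le

theorem exp_neg_mul_le_one {τ φ : ℝ} (hτ : 0 < τ) (hφ : 0 ≤ φ) : Real.exp (-τ * φ) ≤ 1 :=
  Real.exp_le_one_iff.2 (by nlinarith [mul_nonneg hτ.le hφ])

/-! ### Dimension at least three -/

/-- The left side is the Gamma integrand after the substitution `τ ↦ τ⁻¹`, Jacobian included, in the
shape produced by `integral_comp_rpow_Ioi`. -/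
theorem rpow_neg_mul_exp_inv_eq (a p : ℝ) {τ : ℝ} (hτ : 0 < τ) :
    (|(-1 : ℝ)| * τ ^ ((-1 : ℝ) - 1)) •
        ((τ ^ (-1 : ℝ)) ^ (p - 1 - 1) * Real.exp (-(a * τ ^ (-1 : ℝ)))) =
      τ ^ (-p) * Real.exp (-(a * τ⁻¹)) := by
  rw [abs_neg, abs_one, one_mul, smul_eq_mul, ← mul_assoc, ← Real.rpow_mul hτ.le,
    ← Real.rpow_add hτ, Real.rpow_neg_one]
  congr 2
  ring

theorem integrableOn_rpow_neg_mul_exp_inv {a p : ℝ} (ha : 0 < a) (hp : 1 < p) :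
    IntegrableOn (fun τ => τ ^ (-p) * Real.exp (-(a * τ⁻¹))) (Set.Ioi 0) := by
  have h := integrableOn_rpow_mul_exp_neg_mul_rpow (s := p - 1 - 1) (p := 1) (b := a)
    (by linarith) one_pos ha
  simp only [Real.rpow_one, neg_mul] at h
  rw [← integrableOn_Ioi_comp_rpow_iff _ (show (-1 : ℝ) ≠ 0 by norm_num)] at h
  exact h.congr_fun (fun τ (hτ : 0 < τ) => rpow_neg_mul_exp_inv_eq a p hτ) measurableSet_Ioi

theorem integral_rpow_neg_mul_exp_inv {a p : ℝ} (ha : 0 < a) (hp : 1 < p) :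
    ∫ τ in Set.Ioi (0 : ℝ), τ ^ (-p) * Real.exp (-(a * τ⁻¹)) =
      (1 / a) ^ (p - 1) * Real.Gamma (p - 1) := by
  rw [← Real.integral_rpow_mul_exp_neg_mul_Ioi (by linarith) ha,
    ← integral_comp_rpow_Ioi (fun τ => τ ^ (p - 1 - 1) * Real.exp (-(a * τ)))
      (show (-1 : ℝ) ≠ 0 by norm_num)]
  exact setIntegral_congr_fun measurableSet_Ioi
    fun τ (hτ : 0 < τ) => (rpow_neg_mul_exp_inv_eq a p hτ).symm

theorem integrableOn_heatKernel (hd : 3 ≤ d) (hx : x ≠ 0) :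
    IntegrableOn (heatKernel x) (Set.Ioi 0) := by
  have hx' : 0 < ‖x‖ := norm_pos_iff.2 hx
  have hd' : (3 : ℝ) ≤ d := by exact_mod_cast hd
  refine IntegrableOn.congr_fun ((integrableOn_rpow_neg_mul_exp_inv
    (a := ‖x‖ ^ 2 / 2) (p := (d : ℝ) / 2) (by positivity) (by linarith)).const_mul
      ((2 * Real.pi) ^ (-((d : ℝ) / 2)))) (fun τ hτ => (heatKernel_eq x hτ).symm)
    measurableSet_Ioi

theorem integral_heatKernel (hd : 3 ≤ d) (hx : x ≠ 0) :
    ∫ τ in Set.Ioi (0 : ℝ), heatKernel x τ =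
      Real.Gamma ((d : ℝ) / 2 - 1) / (2 * Real.pi ^ ((d : ℝ) / 2)) * ‖x‖ ^ (2 - (d : ℝ)) := by
  have hx' : 0 < ‖x‖ := norm_pos_iff.2 hx
  have hd' : (3 : ℝ) ≤ d := by exact_mod_cast hd
  rw [setIntegral_congr_fun measurableSet_Ioi fun τ hτ => heatKernel_eq x hτ,
    integral_const_mul, integral_rpow_neg_mul_exp_inv (by positivity) (by linarith)]
  have h1 : (1 / (‖x‖ ^ 2 / 2)) ^ ((d : ℝ) / 2 - 1) =
      2 ^ ((d : ℝ) / 2 - 1) * ‖x‖ ^ (2 - (d : ℝ)) := by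
    rw [one_div_div, Real.div_rpow (by norm_num) (by positivity), div_eq_mul_inv,
      ← Real.rpow_neg (by positivity), ← Real.rpow_natCast, ← Real.rpow_mul hx'.le]
    congr 2
    push_cast
    ring
  have h2 : (2 : ℝ) ^ ((d : ℝ) / 2 - 1) = 2 ^ ((d : ℝ) / 2) / 2 := by
    rw [Real.rpow_sub (by norm_num), Real.rpow_one]
  rw [h1, h2, Real.rpow_neg (by positivity), Real.mul_rpow (by norm_num) Real.pi_pos.le]
  field_simp

theorem integrableOn_exp_mul_heatKernel_of_three_le (hd : 3 ≤ d) (hx : x ≠ 0) {φ : ℝ}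
    (hφ : 0 ≤ φ) :
    IntegrableOn (fun τ => Real.exp (-τ * φ) * heatKernel x τ) (Set.Ioi 0) := by
  refine (integrableOn_heatKernel hd hx).mono'
    ((by fun_prop : Measurable fun τ : ℝ => Real.exp (-τ * φ)).mul
      (measurable_heatKernel x)).aestronglyMeasurable ?_
  filter_upwards [ae_restrict_mem measurableSet_Ioi] with τ hτ
  rw [Real.norm_eq_abs, abs_of_nonneg (mul_pos (Real.exp_pos _) (heatKernel_pos x hτ)).le]
  exact mul_le_of_le_one_left (heatKernel_pos x hτ).le (exp_neg_mul_le_one hτ hφ)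

theorem tendsto_resolvent_of_three_le (hd : 3 ≤ d) (hx : x ≠ 0) :
    Tendsto (resolvent x) (𝓝[>] 0)
      (𝓝 (Real.Gamma ((d : ℝ) / 2 - 1) / (2 * Real.pi ^ ((d : ℝ) / 2)) *
        ‖x‖ ^ (2 - (d : ℝ)))) := by
  rw [← integral_heatKernel hd hx]
  refine tendsto_integral_filter_of_dominated_convergence (heatKernel x)
    (Eventually.of_forall fun φ => ((by fun_prop : Measurable fun τ : ℝ =>
      Real.exp (-τ * φ)).mul (measurable_heatKernel x)).aestronglyMeasurable) ?_
    (integrableOn_heatKernel hd hx) ?_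
  · filter_upwards [eventually_mem_nhdsWithin] with φ hφ
    filter_upwards [ae_restrict_mem measurableSet_Ioi] with τ hτ
    rw [Real.norm_eq_abs, abs_of_nonneg (mul_pos (Real.exp_pos _) (heatKernel_pos x hτ)).le]
    exact mul_le_of_le_one_left (heatKernel_pos x hτ).le (exp_neg_mul_le_one hτ (le_of_lt hφ))
  · refine Eventually.of_forall fun τ => tendsto_nhdsWithin_of_tendsto_nhds ?_
    have : Continuous fun φ : ℝ => Real.exp (-τ * φ) * heatKernel x τ := by fun_prop
    simpa using this.tendsto 0

/-! ### Dimension one -/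

theorem integrableOn_rpow_neg_half_mul_exp {φ : ℝ} (hφ : 0 < φ) :
    IntegrableOn (fun τ : ℝ => τ ^ (-(1 / 2) : ℝ) * Real.exp (-τ * φ)) (Set.Ioi 0) := by
  have h := integrableOn_rpow_mul_exp_neg_mul_rpow (s := -(1 / 2)) (p := 1) (b := φ)
    (by norm_num) one_pos hφ
  simp only [Real.rpow_one] at h
  refine h.congr_fun (fun τ _ => ?_) measurableSet_Ioi
  simp only
  congr 2
  ring

theorem exp_mul_heatKernel_one_eq (x : EuclideanSpace ℝ (Fin 1)) {τ φ : ℝ} (hτ : 0 < τ) :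
    Real.exp (-τ * φ) * heatKernel x τ = (2 * Real.pi) ^ (-(1 / 2) : ℝ) *
      (τ ^ (-(1 / 2) : ℝ) * Real.exp (-τ * φ) * Real.exp (-(‖x‖ ^ 2 / 2 * τ⁻¹))) := by
  rw [heatKernel_eq x hτ, Nat.cast_one]
  ring

theorem integrableOn_exp_mul_heatKernel_one (x : EuclideanSpace ℝ (Fin 1)) {φ : ℝ}
    (hφ : 0 < φ) :
    IntegrableOn (fun τ => Real.exp (-τ * φ) * heatKernel x τ) (Set.Ioi 0) := by
  refine ((integrableOn_rpow_neg_half_mul_exp hφ).const_mul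
    ((2 * Real.pi) ^ (-(1 / 2) : ℝ))).mono' ((by fun_prop : Measurable fun τ : ℝ =>
      Real.exp (-τ * φ)).mul (measurable_heatKernel x)).aestronglyMeasurable ?_
  filter_upwards [ae_restrict_mem measurableSet_Ioi] with τ hτ
  have hτ : 0 < τ := hτ
  rw [Real.norm_eq_abs, abs_of_nonneg (mul_pos (Real.exp_pos _) (heatKernel_pos x hτ)).le,
    exp_mul_heatKernel_one_eq x hτ]
  refine mul_le_mul_of_nonneg_left (mul_le_of_le_one_right (by positivity) ?_) (by positivity)
  exact Real.exp_le_one_iff.2 (neg_nonpos.2 (by positivity))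

/-- The scaling `τ ↦ τ/φ` moves all dependence on `φ` into a factor that is at most `1` and tends to
`1`, ready for dominated convergence. -/
theorem rpow_half_mul_resolvent_one (x : EuclideanSpace ℝ (Fin 1)) {φ : ℝ} (hφ : 0 < φ) :
    φ ^ (1 / 2 : ℝ) * resolvent x φ = (2 * Real.pi) ^ (-(1 / 2) : ℝ) *
      ∫ τ in Set.Ioi (0 : ℝ), τ ^ (-(1 / 2) : ℝ) * Real.exp (-τ * 1) *
        Real.exp (-(‖x‖ ^ 2 / 2 * τ⁻¹ * φ)) := by
  have h := integral_comp_mul_left_Ioi (fun τ => Real.exp (-τ * φ) * heatKernel x τ) 0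
    (inv_pos.2 hφ)
  rw [mul_zero, inv_inv, smul_eq_mul] at h
  have h' : resolvent x φ = φ⁻¹ *
      ∫ τ in Set.Ioi (0 : ℝ), Real.exp (-(φ⁻¹ * τ) * φ) * heatKernel x (φ⁻¹ * τ) := by
    rw [h, ← mul_assoc, inv_mul_cancel₀ hφ.ne', one_mul, resolvent]
  rw [h', ← mul_assoc, ← integral_const_mul, ← integral_const_mul]
  refine setIntegral_congr_fun measurableSet_Ioi fun τ hτ => ?_
  have hτ : 0 < τ := hτ
  rw [exp_mul_heatKernel_one_eq x (mul_pos (inv_pos.2 hφ) hτ),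
    Real.mul_rpow (inv_nonneg.2 hφ.le) hτ.le, Real.inv_rpow hφ.le, Real.rpow_neg hφ.le, inv_inv]
  have e1 : -(φ⁻¹ * τ) * φ = -τ * 1 := by field_simp
  have e2 : ‖x‖ ^ 2 / 2 * (φ⁻¹ * τ)⁻¹ = ‖x‖ ^ 2 / 2 * τ⁻¹ * φ := by field_simp
  have e3 : φ ^ (1 / 2 : ℝ) * φ ^ (1 / 2 : ℝ) = φ := by
    rw [← Real.rpow_add hφ]
    norm_num
  rw [e1, e2]
  calc _ = (φ ^ (1 / 2 : ℝ) * φ ^ (1 / 2 : ℝ)) * φ⁻¹ * ((2 * Real.pi) ^ (-(1 / 2) : ℝ) *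
        (τ ^ (-(1 / 2) : ℝ) * Real.exp (-τ * 1) *
          Real.exp (-(‖x‖ ^ 2 / 2 * τ⁻¹ * φ)))) := by ring
    _ = _ := by rw [e3, mul_inv_cancel₀ hφ.ne', one_mul]

theorem tendsto_resolvent_one (x : EuclideanSpace ℝ (Fin 1)) :
    Tendsto (fun φ => φ ^ (1 / 2 : ℝ) * resolvent x φ) (𝓝[>] 0) (𝓝 (Real.sqrt 2)⁻¹) := by
  have hG : ∫ τ in Set.Ioi (0 : ℝ), τ ^ (-(1 / 2) : ℝ) * Real.exp (-τ * 1) =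
      Real.sqrt Real.pi := by
    have := Real.integral_rpow_mul_exp_neg_mul_Ioi (a := 1 / 2) (r := 1) (by norm_num) one_pos
    rw [Real.Gamma_one_half_eq, one_div_one, Real.one_rpow, one_mul] at this
    rw [← this]
    refine setIntegral_congr_fun measurableSet_Ioi fun τ _ => ?_
    norm_num
  have hlim : Tendsto (fun φ : ℝ => ∫ τ in Set.Ioi (0 : ℝ), τ ^ (-(1 / 2) : ℝ) *
      Real.exp (-τ * 1) * Real.exp (-(‖x‖ ^ 2 / 2 * τ⁻¹ * φ))) (𝓝[>] 0)
      (𝓝 (Real.sqrt Real.pi)) := by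
    rw [← hG]
    refine tendsto_integral_filter_of_dominated_convergence _
      (Eventually.of_forall fun φ => by fun_prop) ?_
      (integrableOn_rpow_neg_half_mul_exp one_pos) ?_
    · filter_upwards [eventually_mem_nhdsWithin] with φ hφ
      have hφ : 0 < φ := hφ
      filter_upwards [ae_restrict_mem measurableSet_Ioi] with τ hτ
      have hτ : 0 < τ := hτ
      rw [Real.norm_eq_abs, abs_of_nonneg (by positivity)]
      refine mul_le_of_le_one_right (by positivity) ?_
      exact Real.exp_le_one_iff.2 (neg_nonpos.2 (by positivity))
    · refine Eventually.of_forall fun τ => tendsto_nhdsWithin_of_tendsto_nhds ?_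
      have : Continuous fun φ : ℝ => τ ^ (-(1 / 2) : ℝ) *
        Real.exp (-τ * 1) * Real.exp (-(‖x‖ ^ 2 / 2 * τ⁻¹ * φ)) := by fun_prop
      simpa using this.tendsto 0
  have hval : (Real.sqrt 2)⁻¹ = (2 * Real.pi) ^ (-(1 / 2) : ℝ) * Real.sqrt Real.pi := by
    have : Real.sqrt Real.pi ≠ 0 := (Real.sqrt_pos.2 Real.pi_pos).ne'
    rw [Real.rpow_neg (by positivity), ← Real.sqrt_eq_rpow, Real.sqrt_mul (by norm_num)]
    field_simp
  rw [hval]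
  refine (hlim.const_mul _).congr' ?_
  filter_upwards [eventually_mem_nhdsWithin] with φ hφ
  exact (rpow_half_mul_resolvent_one x hφ).symm

/-! ### Dimension two -/

/-- From `y ≤ e^y` at `y = a/τ`. It tames the singularity `τ⁻¹` at zero, which is why `x ≠ 0` is
needed in dimension two. -/
theorem inv_mul_exp_inv_le {a τ : ℝ} (ha : 0 < a) (hτ : 0 < τ) :
    τ⁻¹ * Real.exp (-(a * τ⁻¹)) ≤ a⁻¹ := by
  have h1 : a * τ⁻¹ ≤ Real.exp (a * τ⁻¹) := by linarith [Real.add_one_le_exp (a * τ⁻¹)]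
  have h2 : 0 < a * τ⁻¹ := by positivity
  rw [Real.exp_neg]
  calc τ⁻¹ * (Real.exp (a * τ⁻¹))⁻¹ ≤ τ⁻¹ * (a * τ⁻¹)⁻¹ := by gcongr
    _ = a⁻¹ := by field_simp

theorem integrableOn_exp_mul_inv_mul_exp {a φ : ℝ} (ha : 0 < a) (hφ : 0 < φ) :
    IntegrableOn (fun τ => Real.exp (-τ * φ) * (τ⁻¹ * Real.exp (-(a * τ⁻¹)))) (Set.Ioi 0) := by
  have hi : IntegrableOn (fun τ => Real.exp (-φ * τ) * a⁻¹) (Set.Ioi 0) :=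
    (exp_neg_integrableOn_Ioi 0 hφ).mul_const _
  refine hi.mono' (by fun_prop) ?_
  filter_upwards [ae_restrict_mem measurableSet_Ioi] with τ hτ
  have hτ : 0 < τ := hτ
  rw [Real.norm_eq_abs, abs_of_nonneg (by positivity), neg_mul, neg_mul, mul_comm τ φ]
  gcongr
  exact inv_mul_exp_inv_le ha hτ

theorem exp_mul_heatKernel_two_eq (x : EuclideanSpace ℝ (Fin 2)) {τ φ : ℝ} (hτ : 0 < τ) :
    Real.exp (-τ * φ) * heatKernel x τ = (2 * Real.pi)⁻¹ *
      (Real.exp (-τ * φ) * (τ⁻¹ * Real.exp (-(‖x‖ ^ 2 / 2 * τ⁻¹)))) := by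
  rw [heatKernel_eq x hτ, Nat.cast_two, div_self two_ne_zero, Real.rpow_neg_one,
    Real.rpow_neg_one]
  ring

theorem integrableOn_exp_mul_heatKernel_two {x : EuclideanSpace ℝ (Fin 2)} (hx : x ≠ 0) {φ : ℝ}
    (hφ : 0 < φ) :
    IntegrableOn (fun τ => Real.exp (-τ * φ) * heatKernel x τ) (Set.Ioi 0) := by
  have hx' : 0 < ‖x‖ := norm_pos_iff.2 hx
  exact IntegrableOn.congr_fun ((integrableOn_exp_mul_inv_mul_exp (a := ‖x‖ ^ 2 / 2)
    (by positivity) hφ).const_mul _) (fun τ hτ => (exp_mul_heatKernel_two_eq x hτ).symm)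
    measurableSet_Ioi

/-- The integrand behaves like `τ⁻¹` between `1` and `1/φ`, which produces the logarithm. The piece
`(0, 1]` contributes at most `a⁻¹` and the piece beyond `1/φ` at most `1`. -/
theorem abs_integral_exp_sub_log_le {a φ : ℝ} (ha : 0 < a) (hφ : 0 < φ) (hφ1 : φ ≤ 1) :
    |(∫ τ in Set.Ioi (0 : ℝ), Real.exp (-τ * φ) * (τ⁻¹ * Real.exp (-(a * τ⁻¹)))) -
      Real.log φ⁻¹| ≤ a⁻¹ + 1 + a := by
  set f : ℝ → ℝ := fun τ => Real.exp (-τ * φ) * (τ⁻¹ * Real.exp (-(a * τ⁻¹))) with hf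
  have hi : IntegrableOn f (Set.Ioi 0) := integrableOn_exp_mul_inv_mul_exp ha hφ
  have hφi : 1 ≤ φ⁻¹ := (one_le_inv₀ hφ).2 hφ1
  have i1 : IntegrableOn f (Set.Ioc 0 1) := hi.mono_set Set.Ioc_subset_Ioi_self
  have i2 : IntegrableOn f (Set.Ioi 1) := hi.mono_set (Set.Ioi_subset_Ioi zero_le_one)
  have i3 : IntegrableOn f (Set.Ioc 1 φ⁻¹) := i2.mono_set Set.Ioc_subset_Ioi_self
  have i4 : IntegrableOn f (Set.Ioi φ⁻¹) := i2.mono_set (Set.Ioi_subset_Ioi hφi)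
  have hsplit : ∫ τ in Set.Ioi (0 : ℝ), f τ = (∫ τ in Set.Ioc 0 1, f τ) +
      ((∫ τ in Set.Ioc 1 φ⁻¹, f τ) + ∫ τ in Set.Ioi φ⁻¹, f τ) := by
    rw [← setIntegral_union Set.Ioc_disjoint_Ioi_same measurableSet_Ioi i3 i4,
      Set.Ioc_union_Ioi_eq_Ioi hφi,
      ← setIntegral_union Set.Ioc_disjoint_Ioi_same measurableSet_Ioi i1 i2,
      Set.Ioc_union_Ioi_eq_Ioi zero_le_one]
  have hfd : ∀ τ, f τ = Real.exp (-(φ * τ)) * (τ⁻¹ * Real.exp (-(a * τ⁻¹))) := fun τ => by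
    change Real.exp (-τ * φ) * _ = _
    rw [neg_mul, mul_comm τ φ]
  have hf0 : ∀ τ, 0 < τ → 0 ≤ f τ := fun τ hτ => by rw [hf]; positivity
  have hfle : ∀ τ, 0 < τ → f τ ≤ τ⁻¹ * Real.exp (-(a * τ⁻¹)) := fun τ hτ =>
    mul_le_of_le_one_left (by positivity) (exp_neg_mul_le_one hτ hφ.le)
  have n1 : 0 ≤ ∫ τ in Set.Ioc 0 1, f τ :=
    setIntegral_nonneg measurableSet_Ioc fun τ hτ => hf0 τ hτ.1
  have n4 : 0 ≤ ∫ τ in Set.Ioi φ⁻¹, f τ :=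
    setIntegral_nonneg measurableSet_Ioi fun τ hτ => hf0 τ ((inv_pos.2 hφ).trans hτ)
  have u1 : ∫ τ in Set.Ioc 0 1, f τ ≤ a⁻¹ := by
    calc _ ≤ ∫ τ in Set.Ioc (0 : ℝ) 1, a⁻¹ :=
          setIntegral_mono_on i1 (integrableOn_const (by simp)) measurableSet_Ioc
            fun τ hτ => (hfle τ hτ.1).trans (inv_mul_exp_inv_le ha hτ.1)
      _ = a⁻¹ := by simp
  have hinv : IntegrableOn (fun τ : ℝ => τ⁻¹) (Set.Ioc 1 φ⁻¹) := by
    rw [← intervalIntegrable_iff_integrableOn_Ioc_of_le hφi]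
    refine intervalIntegral.intervalIntegrable_inv (fun τ hτ => ?_) continuousOn_id
    rw [Set.uIcc_of_le hφi] at hτ
    exact (one_pos.trans_le hτ.1).ne'
  have hlog : ∫ τ in Set.Ioc 1 φ⁻¹, τ⁻¹ = Real.log φ⁻¹ := by
    rw [← intervalIntegral.integral_of_le hφi,
      integral_inv_of_pos one_pos (inv_pos.2 hφ), div_one]
  have u3 : ∫ τ in Set.Ioc 1 φ⁻¹, f τ ≤ Real.log φ⁻¹ := by
    rw [← hlog]
    refine setIntegral_mono_on i3 hinv measurableSet_Ioc fun τ hτ => ?_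
    have hτ0 : 0 < τ := one_pos.trans hτ.1
    refine (hfle τ hτ0).trans (mul_le_of_le_one_right (by positivity) ?_)
    exact Real.exp_le_one_iff.2 (neg_nonpos.2 (by positivity))
  have u4 : ∫ τ in Set.Ioi φ⁻¹, f τ ≤ 1 := by
    have hj : IntegrableOn (fun τ => φ * Real.exp (-φ * τ)) (Set.Ioi φ⁻¹) :=
      (exp_neg_integrableOn_Ioi _ hφ).const_mul φ
    calc _ ≤ ∫ τ in Set.Ioi φ⁻¹, φ * Real.exp (-φ * τ) := by
          refine setIntegral_mono_on i4 hj measurableSet_Ioi fun τ hτ => ?_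
          have hτ0 : 0 < τ := (inv_pos.2 hφ).trans hτ
          have h1 : τ⁻¹ ≤ φ := inv_le_of_inv_le₀ hφ (le_of_lt hτ)
          have h2 : Real.exp (-(a * τ⁻¹)) ≤ 1 :=
            Real.exp_le_one_iff.2 (neg_nonpos.2 (by positivity))
          rw [hfd, neg_mul, mul_comm φ (Real.exp _)]
          refine mul_le_mul_of_nonneg_left ?_ (Real.exp_pos _).le
          calc τ⁻¹ * Real.exp (-(a * τ⁻¹)) ≤ φ * 1 := by gcongr
            _ = φ := mul_one φ
      _ = Real.exp (-1) := by
          rw [integral_const_mul, integral_exp_mul_Ioi (neg_lt_zero.2 hφ), neg_div_neg_eq,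
            neg_mul, mul_inv_cancel₀ hφ.ne']
          field_simp
      _ ≤ 1 := Real.exp_le_one_iff.2 (by norm_num)
  -- The bound `e^{-y} ≥ 1 - y` with `y = φτ + a/τ` minorises the integrand by `τ⁻¹ - φ - aτ⁻²`; the
  -- last two terms cost at most `1` and `a`.
  have l3 : Real.log φ⁻¹ - 1 - a ≤ ∫ τ in Set.Ioc 1 φ⁻¹, f τ := by
    have hsq : IntegrableOn (fun τ : ℝ => τ ^ (-2 : ℝ)) (Set.Ioi 1) :=
      integrableOn_Ioi_rpow_of_lt (by norm_num) one_pos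
    have hsq' : IntegrableOn (fun τ : ℝ => a * τ ^ (-2 : ℝ)) (Set.Ioc 1 φ⁻¹) :=
      (hsq.mono_set Set.Ioc_subset_Ioi_self).const_mul a
    have hc : IntegrableOn (fun _ : ℝ => φ) (Set.Ioc 1 φ⁻¹) := integrableOn_const (by simp)
    have hsqle : ∫ τ in Set.Ioc 1 φ⁻¹, a * τ ^ (-2 : ℝ) ≤ a := by
      rw [integral_const_mul]
      have : ∫ τ in Set.Ioc 1 φ⁻¹, τ ^ (-2 : ℝ) ≤ ∫ τ in Set.Ioi (1 : ℝ), τ ^ (-2 : ℝ) := by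
        refine setIntegral_mono_set hsq ?_ (Set.Ioc_subset_Ioi_self.eventuallyLE)
        filter_upwards [ae_restrict_mem measurableSet_Ioi] with τ hτ
        exact Real.rpow_nonneg (zero_le_one.trans (le_of_lt hτ)) _
      rw [integral_Ioi_rpow_of_lt (by norm_num) one_pos] at this
      refine (mul_le_mul_of_nonneg_left this ha.le).trans (le_of_eq ?_)
      norm_num
    have hcle : ∫ _ in Set.Ioc 1 φ⁻¹, φ ≤ 1 := by
      rw [setIntegral_const, Real.volume_real_Ioc_of_le hφi, smul_eq_mul, sub_mul,
        inv_mul_cancel₀ hφ.ne']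
      linarith
    have hmono : ∫ τ in Set.Ioc 1 φ⁻¹, (τ⁻¹ - φ - a * τ ^ (-2 : ℝ)) ≤
        ∫ τ in Set.Ioc 1 φ⁻¹, f τ := by
      refine setIntegral_mono_on ((hinv.sub hc).sub hsq') i3 measurableSet_Ioc fun τ hτ => ?_
      have hτ0 : 0 < τ := one_pos.trans hτ.1
      have e1 : τ ^ (-2 : ℝ) = τ⁻¹ * τ⁻¹ := by
        rw [← Real.rpow_neg_one, ← Real.rpow_add hτ0]
        norm_num
      have e2 : f τ = τ⁻¹ * Real.exp (-(τ * φ) - a * τ⁻¹) := by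
        rw [hfd, sub_eq_add_neg, Real.exp_add, mul_comm φ τ]
        ring
      have e3 := Real.add_one_le_exp (-(τ * φ) - a * τ⁻¹)
      rw [e2, e1]
      calc τ⁻¹ - φ - a * (τ⁻¹ * τ⁻¹) = τ⁻¹ * (-(τ * φ) - a * τ⁻¹ + 1) := by
            field_simp
            ring
        _ ≤ _ := by gcongr
    rw [integral_sub (f := fun τ : ℝ => τ⁻¹ - φ) (hinv.sub hc) hsq', integral_sub hinv hc,
      hlog] at hmono
    linarith
  have := inv_pos.2 ha
  rw [hsplit, abs_le]
  constructor <;> linarith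

theorem tendsto_div_of_abs_sub_le {ι : Type*} {l : Filter ι} {N D : ι → ℝ} {B : ℝ}
    (hD : Tendsto D l atTop) (hB : ∀ᶠ i in l, |N i - D i| ≤ B) :
    Tendsto (fun i => N i / D i) l (𝓝 1) := by
  have h0 : Tendsto (fun i => (N i - D i) / D i) l (𝓝 0) := by
    refine squeeze_zero_norm' (a := fun i => B / D i) ?_ (hD.const_div_atTop B)
    filter_upwards [hB, hD.eventually_gt_atTop 0] with i hi hi'
    rw [norm_div, Real.norm_eq_abs, Real.norm_eq_abs, abs_of_pos hi']
    gcongr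
  have h1 := h0.const_add 1
  rw [add_zero] at h1
  refine h1.congr' ?_
  filter_upwards [hD.eventually_gt_atTop 0] with i hi
  field_simp
  ring

theorem tendsto_resolvent_two {x : EuclideanSpace ℝ (Fin 2)} (hx : x ≠ 0) :
    Tendsto (fun φ => resolvent x φ / ((2 * Real.pi)⁻¹ * Real.log φ⁻¹)) (𝓝[>] 0) (𝓝 1) := by
  have hx' : 0 < ‖x‖ := norm_pos_iff.2 hx
  have ha : 0 < ‖x‖ ^ 2 / 2 := by positivity
  have hlog : Tendsto (fun φ : ℝ => Real.log φ⁻¹) (𝓝[>] 0) atTop :=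
    Real.tendsto_log_atTop.comp tendsto_inv_nhdsGT_zero
  have h1 : ∀ᶠ φ : ℝ in 𝓝[>] 0, φ ≤ 1 :=
    (eventually_le_nhds one_pos).filter_mono nhdsWithin_le_nhds
  have := tendsto_div_of_abs_sub_le (N := fun φ => ∫ τ in Set.Ioi (0 : ℝ),
    Real.exp (-τ * φ) * (τ⁻¹ * Real.exp (-(‖x‖ ^ 2 / 2 * τ⁻¹)))) hlog (by
      filter_upwards [h1, eventually_mem_nhdsWithin] with φ h1 h0
      exact abs_integral_exp_sub_log_le ha h0 h1)
  refine this.congr fun φ => ?_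
  rw [resolvent, setIntegral_congr_fun measurableSet_Ioi
    fun τ hτ => exp_mul_heatKernel_two_eq x hτ, integral_const_mul,
    mul_div_mul_left _ _ (by positivity)]

end Resolvent

/-! ### The subordinated heat kernel -/

section Cesaro

variable {Ω : Type*} [MeasurableSpace Ω] {P : Measure Ω} [IsProbabilityMeasure P]
  {σ : Measure ℝ} {S : ℝ≥0 → Ω → ℝ} {d : ℕ} {x : EuclideanSpace ℝ (Fin d)}

/-- The subordinated heat kernel as an extended nonnegative number. -/
noncomputable def lsubordinatedKernel (hS : IsSubordinator S σ P)
    (x : EuclideanSpace ℝ (Fin d)) (t : ℝ) : ℝ≥0∞ :=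
  ∫⁻ τ in Set.Ioi (0 : ℝ), ENNReal.ofReal (heatKernel x τ) * inverseLaw hS t τ

theorem measurable_integrand_lsubordinatedKernel (hS : IsSubordinator S σ P)
    (x : EuclideanSpace ℝ (Fin d)) :
    Measurable (Function.uncurry fun t τ =>
      ENNReal.ofReal (heatKernel x τ) * inverseLaw hS t τ) :=
  (((measurable_heatKernel x).ennreal_ofReal).comp measurable_snd).mul (measurable_inverseLaw hS)

theorem measurable_lsubordinatedKernel (hS : IsSubordinator S σ P)
    (x : EuclideanSpace ℝ (Fin d)) : Measurable (lsubordinatedKernel hS x) :=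
  (measurable_integrand_lsubordinatedKernel hS x).lintegral_prod_right'

/-- By Tonelli the transform in `t` acts on the density alone, giving `(Φ/λ) e^{-τΦ}`; integrating
this against the heat kernel is the Green function at `Φ(λ)`. -/
theorem laplace_lsubordinatedKernel (hσ : IsLevyMeasure σ) (hS : IsSubordinator S σ P) {lam : ℝ}
    (hlam : 0 < lam) (hi : IntegrableOn
      (fun τ => Real.exp (-τ * laplaceExponent σ lam) * heatKernel x τ) (Set.Ioi 0)) :
    laplace (lsubordinatedKernel hS x) lam = ENNReal.ofReal
      (laplaceExponent σ lam / lam * resolvent x (laplaceExponent σ lam)) := by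
  have hc : 0 ≤ laplaceExponent σ lam / lam :=
    div_nonneg (hσ.laplaceExponent_pos hlam).le hlam.le
  unfold lsubordinatedKernel
  rw [laplace_lintegral _ (measurable_integrand_lsubordinatedKernel hS x),
    ENNReal.ofReal_mul hc, resolvent, ofReal_integral_eq_lintegral_ofReal hi,
    ← lintegral_const_mul' _ _ ENNReal.ofReal_ne_top]
  · refine setLIntegral_congr_fun measurableSet_Ioi fun τ hτ => ?_
    have hτ : 0 < τ := hτ
    have h1 : laplace (fun t => ENNReal.ofReal (heatKernel x τ) * inverseLaw hS t τ) lam =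
        ENNReal.ofReal (heatKernel x τ) * laplace (fun t => inverseLaw hS t τ) lam := by
      unfold laplace
      rw [← lintegral_const_mul' _ _ ENNReal.ofReal_ne_top]
      exact lintegral_congr fun t => by ring
    change laplace (fun t => ENNReal.ofReal (heatKernel x τ) * inverseLaw hS t τ) lam = _
    rw [h1, laplace_inverseLaw hσ hS hτ.le hlam, ENNReal.ofReal_mul hc,
      ENNReal.ofReal_mul (Real.exp_pos _).le]
    ring
  · filter_upwards [ae_restrict_mem measurableSet_Ioi] with τ hτ
    exact (mul_pos (Real.exp_pos _) (heatKernel_pos x hτ)).le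

theorem ae_subordinatedKernel_eq (hσ : IsLevyMeasure σ) (hS : IsSubordinator S σ P)
    (x : EuclideanSpace ℝ (Fin d)) :
    ∀ᵐ t ∂volume.restrict (Set.Ioi (0 : ℝ)),
      subordinatedKernel S P x t = (lsubordinatedKernel hS x t).toReal := by
  filter_upwards [ae_inverseDensity hσ hS] with t ht
  have hm : Measurable (inverseLaw hS t) := (measurable_inverseLaw hS).of_uncurry_left
  have hmr : Measurable fun τ => heatKernel x τ * (inverseLaw hS t τ).toReal :=
    (measurable_heatKernel x).mul hm.ennreal_toReal
  have h1 : subordinatedKernel S P x t =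
      ∫ τ in Set.Ioi (0 : ℝ), heatKernel x τ * (inverseLaw hS t τ).toReal :=
    integral_congr_ae (ht.mono fun τ hτ => by simp only [hτ.2])
  have h0 : 0 ≤ᵐ[volume.restrict (Set.Ioi (0 : ℝ))]
      fun τ => heatKernel x τ * (inverseLaw hS t τ).toReal := by
    filter_upwards [ae_restrict_mem measurableSet_Ioi] with τ hτ
    exact mul_nonneg (heatKernel_pos x hτ).le ENNReal.toReal_nonneg
  rw [h1, integral_eq_lintegral_of_nonneg_ae h0 hmr.aestronglyMeasurable, lsubordinatedKernel]
  congr 1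
  refine lintegral_congr_ae ?_
  filter_upwards [ht, ae_restrict_mem measurableSet_Ioi] with τ hτ hτ0
  rw [ENNReal.ofReal_mul (heatKernel_pos x hτ0).le, ENNReal.ofReal_toReal hτ.1]

/-- The null set of times where the density is not identified disappears under the integral. Almost
everywhere finiteness, needed to pass through `toReal`, follows from the finite Laplace transform at
`1`. -/
theorem cesaroMean_subordinatedKernel (hσ : IsLevyMeasure σ) (hS : IsSubordinator S σ P)
    (hi : ∀ φ, 0 < φ →
      IntegrableOn (fun τ => Real.exp (-τ * φ) * heatKernel x τ) (Set.Ioi 0))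
    {t : ℝ} (ht : 0 < t) :
    cesaroMean (subordinatedKernel S P x) t =
      t⁻¹ * (∫⁻ r in Set.Ioc 0 t, lsubordinatedKernel hS x r).toReal := by
  have hm := measurable_lsubordinatedKernel hS x
  have hfin : ∀ᵐ r ∂volume.restrict (Set.Ioi (0 : ℝ)), lsubordinatedKernel hS x r < ∞ := by
    have h := laplace_lsubordinatedKernel hσ hS one_pos
      (hi _ (hσ.laplaceExponent_pos one_pos))
    have h2 := ae_lt_top (μ := volume.restrict (Set.Ioi (0 : ℝ)))
      (f := fun r => ENNReal.ofReal (Real.exp (-1 * r)) * lsubordinatedKernel hS x r)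
      (by fun_prop) (by
        change laplace (lsubordinatedKernel hS x) 1 ≠ ∞
        rw [h]
        exact ENNReal.ofReal_ne_top)
    refine h2.mono fun r hr => ?_
    by_contra htop
    rw [not_lt_top_iff.1 htop, ENNReal.mul_top (by simp [Real.exp_pos])] at hr
    exact lt_irrefl _ hr
  have hle : volume.restrict (Set.Ioc 0 t) ≤ volume.restrict (Set.Ioi (0 : ℝ)) :=
    Measure.restrict_mono Set.Ioc_subset_Ioi_self le_rfl
  rw [cesaroMean, one_div, intervalIntegral.integral_of_le ht.le,
    integral_congr_ae (ae_mono hle (ae_subordinatedKernel_eq hσ hS x)),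
    integral_toReal hm.aemeasurable (ae_mono hle hfin)]

/-- The Tauberian theorem for the Cesàro means of the subordinated heat kernel. -/
theorem cesaroMean_isEquivalent (hσ : IsLevyMeasure σ) (hS : IsSubordinator S σ P)
    (hi : ∀ φ, 0 < φ →
      IntegrableOn (fun τ => Real.exp (-τ * φ) * heatKernel x τ) (Set.Ioi 0))
    {g : ℝ → ℝ}
    (hg : Tendsto (fun t => laplaceExponent σ t⁻¹ * resolvent x (laplaceExponent σ t⁻¹) / g t)
      atTop (𝓝 1))
    (hslow : ∀ c : ℝ, 0 < c → Tendsto (fun t => g (c * t) / g t) atTop (𝓝 1)) :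
    cesaroMean (subordinatedKernel S P x) ~[atTop] g := by
  set u : ℝ → ℝ := fun lam => laplaceExponent σ lam / lam * resolvent x (laplaceExponent σ lam)
    with hu
  have hupos : ∀ lam, 0 < lam → 0 < u lam := fun lam hl =>
    mul_pos (div_pos (hσ.laplaceExponent_pos hl) hl)
      (resolvent_pos (hi _ (hσ.laplaceExponent_pos hl)))
  have hq : Tendsto (fun t => t⁻¹ * u t⁻¹ / g t) atTop (𝓝 1) := by
    refine hg.congr' ?_
    filter_upwards [eventually_gt_atTop 0] with t ht
    rw [hu]
    field_simp
  have hvar : ∀ n : ℕ, Tendsto (fun lam => u ((n + 1) * lam) / u lam) (𝓝[>] 0)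
      (𝓝 ((n + 1 : ℝ)⁻¹)) := by
    intro n
    have hn : (0 : ℝ) < n + 1 := by positivity
    have hn' : (0 : ℝ) < (n + 1 : ℝ)⁻¹ := inv_pos.2 hn
    have h1 : Tendsto (fun t : ℝ => (n + 1 : ℝ)⁻¹ * t) atTop atTop :=
      tendsto_id.const_mul_atTop hn'
    have h2 := (((hq.comp h1).mul (hslow _ hn')).div hq one_ne_zero).const_mul ((n + 1 : ℝ)⁻¹)
    rw [mul_one, div_one, mul_one] at h2
    refine (h2.comp tendsto_inv_nhdsGT_zero).congr' ?_
    -- Division by zero returns `0`, so a quotient tending to `1` forces `g` to be eventually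
    -- nonzero.
    have hne : ∀ᶠ t in atTop, g t ≠ 0 := by
      filter_upwards [hq.eventually_ne one_ne_zero] with t ht h
      simp [h] at ht
    filter_upwards [eventually_mem_nhdsWithin, tendsto_inv_nhdsGT_zero.eventually hne,
      (h1.comp tendsto_inv_nhdsGT_zero).eventually hne] with lam hl e1 e2
    have hl : 0 < lam := hl
    have hul := (hupos lam hl).ne'
    simp only [Function.comp_apply, Pi.div_apply] at e2 ⊢
    have e3 : ((n + 1 : ℝ)⁻¹ * lam⁻¹)⁻¹ = (n + 1) * lam := by rw [mul_inv, inv_inv, inv_inv]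
    rw [e3, inv_inv]
    generalize g ((n + 1 : ℝ)⁻¹ * lam⁻¹) = b at e2 ⊢
    generalize g lam⁻¹ = b' at e1 ⊢
    generalize u lam = a at hul ⊢
    generalize u ((n + 1) * lam) = a'
    field_simp
  have hK := tendsto_setLIntegral_div_laplace (measurable_lsubordinatedKernel hS x)
    (fun lam hl => laplace_lsubordinatedKernel hσ hS hl (hi _ (hσ.laplaceExponent_pos hl)))
    hupos hvar
  -- At `λ = 1/t`, Karamata gives `∫_0^t v^E ~ u(1/t)`, while `u(1/t)/t ~ g(t)`.
  have hfinal := (hK.comp tendsto_inv_atTop_nhdsGT_zero).mul hq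
  rw [mul_one] at hfinal
  refine isEquivalent_of_tendsto_one (hfinal.congr' ?_)
  filter_upwards [eventually_gt_atTop 0] with t ht
  have hut := (hupos t⁻¹ (inv_pos.2 ht)).ne'
  rw [Pi.div_apply, cesaroMean_subordinatedKernel hσ hS hi ht]
  simp only [Function.comp_apply, inv_inv]
  change _ / u t⁻¹ * _ = _
  generalize u t⁻¹ = a at hut ⊢
  field_simp

/-! ### Asymptotics of the Laplace exponent -/

theorem tendsto_laplaceExponent_div (hσ : IsLevyMeasure σ) {C p : ℝ} (hC : 0 < C)
    (hK : kernelLaplace σ ~[𝓝[>] (0 : ℝ)] fun lam => C * lam⁻¹ * Real.log (1 / lam) ^ p) :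
    Tendsto (fun t => laplaceExponent σ t⁻¹ / (C * Real.log t ^ p)) atTop (𝓝 1) := by
  have h := hK.comp_tendsto tendsto_inv_atTop_nhdsGT_zero
  rw [isEquivalent_iff_tendsto_one] at h
  · refine h.congr' ?_
    filter_upwards [eventually_gt_atTop 1] with t ht
    have ht0 : 0 < t := one_pos.trans ht
    have := (Real.rpow_pos_of_pos (Real.log_pos ht) p).ne'
    simp only [Pi.div_apply, Function.comp_apply, inv_inv, one_div]
    rw [hσ.kernelLaplace_eq (inv_pos.2 ht0)]
    field_simp
  · filter_upwards [eventually_gt_atTop 1] with t ht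
    have ht0 : 0 < t := one_pos.trans ht
    have := Real.rpow_pos_of_pos (Real.log_pos ht) p
    simp only [Function.comp_apply, inv_inv, one_div]
    positivity

theorem tendsto_log_rpow_nhds_zero {q : ℝ} (hq : q < 0) :
    Tendsto (fun t => Real.log t ^ q) atTop (𝓝 0) := by
  have := (tendsto_rpow_neg_atTop (neg_pos.2 hq)).comp Real.tendsto_log_atTop
  rw [neg_neg] at this
  exact this

theorem tendsto_laplaceExponent_nhdsGT (hσ : IsLevyMeasure σ) {C p : ℝ} (hC : 0 < C)
    (hp : p < 0)
    (hK : kernelLaplace σ ~[𝓝[>] (0 : ℝ)] fun lam => C * lam⁻¹ * Real.log (1 / lam) ^ p) :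
    Tendsto (fun t => laplaceExponent σ t⁻¹) atTop (𝓝[>] 0) := by
  refine tendsto_nhdsWithin_iff.2 ⟨?_, ?_⟩
  · have h := (tendsto_laplaceExponent_div hσ hC hK).mul
      ((tendsto_log_rpow_nhds_zero hp).const_mul C)
    rw [mul_zero, mul_zero] at h
    refine h.congr' ?_
    filter_upwards [eventually_gt_atTop 1] with t ht
    have := (Real.rpow_pos_of_pos (Real.log_pos ht) p).ne'
    field_simp
  · filter_upwards [eventually_gt_atTop 0] with t ht
    exact hσ.laplaceExponent_pos (inv_pos.2 ht)

theorem tendsto_log_const_mul_div {c : ℝ} (hc : 0 < c) :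
    Tendsto (fun t => Real.log (c * t) / Real.log t) atTop (𝓝 1) := by
  refine tendsto_div_of_abs_sub_le (B := |Real.log c|) Real.tendsto_log_atTop ?_
  filter_upwards [eventually_gt_atTop 0] with t ht
  rw [Real.log_mul hc.ne' ht.ne', add_sub_cancel_right]

theorem tendsto_log_const_mul_rpow_div {c : ℝ} (hc : 0 < c) (q : ℝ) :
    Tendsto (fun t => Real.log (c * t) ^ q / Real.log t ^ q) atTop (𝓝 1) := by
  have h := (tendsto_log_const_mul_div hc).rpow_const (p := q) (Or.inl one_ne_zero)
  rw [Real.one_rpow] at h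
  refine h.congr' ?_
  filter_upwards [eventually_gt_atTop 1,
    (tendsto_id.const_mul_atTop hc).eventually_gt_atTop 1] with t h1 h2
  exact Real.div_rpow (Real.log_pos h2).le (Real.log_pos h1).le q

theorem neg_one_sub_neg {s : ℝ} (hs : 0 < s) : -1 - s < 0 := by linarith

theorem log_const_mul_log_rpow {A q t : ℝ} (hA : 0 < A) (ht : 1 < t) :
    Real.log (A * Real.log t ^ q) = Real.log A + q * Real.log (Real.log t) := by
  have h := Real.log_pos ht
  rw [Real.log_mul hA.ne' (Real.rpow_pos_of_pos h q).ne', Real.log_rpow h]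

theorem tendsto_neg_log_const_mul_log_rpow {A q : ℝ} (hA : 0 < A) (hq : q < 0) :
    Tendsto (fun t => -Real.log (A * Real.log t ^ q)) atTop atTop := by
  have h : Tendsto (fun t => -Real.log A + -q * Real.log (Real.log t)) atTop atTop :=
    tendsto_atTop_add_const_left _ _
      ((Real.tendsto_log_atTop.comp Real.tendsto_log_atTop).const_mul_atTop (neg_pos.2 hq))
  refine h.congr' ?_
  filter_upwards [eventually_gt_atTop 1] with t ht
  rw [log_const_mul_log_rpow hA ht]
  ring

theorem eventually_abs_le_of_tendsto {ι : Type*} {l : Filter ι} {f : ι → ℝ} {a : ℝ}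
    (h : Tendsto f l (𝓝 a)) : ∀ᶠ i in l, |f i| ≤ |a| + 1 :=
  (h.abs.eventually_lt_const (lt_add_one _)).mono fun _ hi => hi.le

/-- The two logarithms differ by `q log(log(ct)/log t)`, which stays bounded, while each diverges
like `q log log t`. -/
theorem tendsto_log_rpow_ratio {A q c : ℝ} (hA : 0 < A) (hq : q < 0) (hc : 0 < c) :
    Tendsto (fun t => Real.log (A * Real.log (c * t) ^ q) / Real.log (A * Real.log t ^ q)) atTop
      (𝓝 1) := by
  have hl := (tendsto_log_const_mul_div hc).log one_ne_zero
  have hb := eventually_abs_le_of_tendsto (hl.const_mul q)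
  have := tendsto_div_of_abs_sub_le (N := fun t => -Real.log (A * Real.log (c * t) ^ q))
    (B := |q * Real.log 1| + 1) (tendsto_neg_log_const_mul_log_rpow hA hq) (by
      filter_upwards [hb, eventually_gt_atTop 1,
        (tendsto_id.const_mul_atTop hc).eventually_gt_atTop 1] with t h0 h1 h2
      have h2 : 1 < c * t := h2
      rw [log_const_mul_log_rpow hA h1, log_const_mul_log_rpow hA h2, ← abs_neg]
      rw [Real.log_div (Real.log_pos h2).ne' (Real.log_pos h1).ne'] at h0
      convert h0 using 2
      ring)
  exact this.congr fun t => neg_div_neg_eq _ _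

/-! ### The three regimes -/

theorem cesaroMean_isEquivalent_one (hσ : IsLevyMeasure σ) (hS : IsSubordinator S σ P)
    {C s : ℝ} (hC : 0 < C) (hs : 0 < s)
    (hK : kernelLaplace σ ~[𝓝[>] (0 : ℝ)]
      fun lam => C * lam⁻¹ * Real.log (1 / lam) ^ (-1 - s)) (x : EuclideanSpace ℝ (Fin 1)) :
    cesaroMean (subordinatedKernel S P x) ~[atTop]
      fun t => Real.sqrt (C / 2) * Real.log t ^ (-(1 + s) / 2) *
        Real.exp (-(Real.sqrt C * Real.sqrt 2 * ‖x‖ * Real.log t ^ (-(1 + s) / 2))) := by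
  set q : ℝ := -(1 + s) / 2 with hq
  set K : ℝ := Real.sqrt C * Real.sqrt 2 * ‖x‖ with hKdef
  have hq0 : q < 0 := by rw [hq]; linarith
  -- For fixed `x` the exponential factor tends to `1`, so it affects neither the equivalence nor
  -- slow variation.
  have hexp : Tendsto (fun t => Real.exp (-(K * Real.log t ^ q))) atTop (𝓝 1) := by
    have h := (((tendsto_log_rpow_nhds_zero hq0).const_mul K).neg).rexp
    rwa [mul_zero, neg_zero, Real.exp_zero] at h
  refine cesaroMean_isEquivalent hσ hS (fun φ hφ => integrableOn_exp_mul_heatKernel_one x hφ)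
    ?_ ?_
  · have h1 := (tendsto_laplaceExponent_div hσ hC hK).rpow_const (p := (1 / 2 : ℝ))
      (Or.inl one_ne_zero)
    have h2 := (tendsto_resolvent_one x).comp
      (tendsto_laplaceExponent_nhdsGT hσ hC (neg_one_sub_neg hs) hK)
    have h3 := ((h1.mul h2).mul_const (Real.sqrt 2)).div hexp one_ne_zero
    rw [Real.one_rpow, one_mul, inv_mul_cancel₀ (by positivity), div_one] at h3
    refine h3.congr' ?_
    filter_upwards [eventually_gt_atTop 1] with t ht
    have hL := Real.log_pos ht
    have hΦ := hσ.laplaceExponent_pos (inv_pos.2 (one_pos.trans ht))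
    have e1 : (C * Real.log t ^ (-1 - s)) ^ (1 / 2 : ℝ) = Real.sqrt C * Real.log t ^ q := by
      rw [Real.mul_rpow hC.le (Real.rpow_nonneg hL.le _), ← Real.rpow_mul hL.le,
        ← Real.sqrt_eq_rpow, hq]
      congr 2
      ring
    have e2 : laplaceExponent σ t⁻¹ ^ (1 / 2 : ℝ) * laplaceExponent σ t⁻¹ ^ (1 / 2 : ℝ) =
        laplaceExponent σ t⁻¹ := by
      rw [← Real.rpow_add hΦ]
      norm_num
    have hLq := Real.rpow_pos_of_pos hL q
    have hsC := Real.sqrt_pos.2 hC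
    simp only [Pi.div_apply, Function.comp_apply]
    rw [Real.div_rpow hΦ.le (by positivity), e1, Real.sqrt_div hC.le]
    generalize resolvent x (laplaceExponent σ t⁻¹) = R
    generalize laplaceExponent σ t⁻¹ ^ (1 / 2 : ℝ) = y at e2 ⊢
    rw [← e2]
    field_simp
  · intro c hc
    have h := (tendsto_log_const_mul_rpow_div hc q).mul
      ((hexp.comp (tendsto_id.const_mul_atTop hc)).div hexp one_ne_zero)
    rw [div_one, mul_one] at h
    refine h.congr fun t => ?_
    have hsC := Real.sqrt_pos.2 (show 0 < C / 2 by positivity)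
    simp only [Pi.div_apply, Function.comp_apply, id]
    rw [mul_div_mul_comm, mul_div_mul_comm, div_self hsC.ne', one_mul]

theorem cesaroMean_isEquivalent_two (hσ : IsLevyMeasure σ) (hS : IsSubordinator S σ P)
    {C s : ℝ} (hC : 0 < C) (hs : 0 < s)
    (hK : kernelLaplace σ ~[𝓝[>] (0 : ℝ)]
      fun lam => C * lam⁻¹ * Real.log (1 / lam) ^ (-1 - s)) {x : EuclideanSpace ℝ (Fin 2)}
    (hx : x ≠ 0) :
    cesaroMean (subordinatedKernel S P x) ~[atTop]
      fun t => -(C / Real.pi) * Real.log t ^ (-1 - s) *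
        Real.log (Real.sqrt (2 * C) * ‖x‖ * Real.log t ^ (-(1 + s) / 2)) := by
  set q : ℝ := -(1 + s) / 2 with hq
  set A : ℝ := Real.sqrt (2 * C) * ‖x‖ with hA
  have hq0 : q < 0 := by rw [hq]; linarith
  have hp : -1 - s = 2 * q := by rw [hq]; ring
  have hA0 : 0 < A := mul_pos (Real.sqrt_pos.2 (by positivity)) (norm_pos_iff.2 hx)
  have hD := tendsto_neg_log_const_mul_log_rpow hA0 hq0
  refine cesaroMean_isEquivalent hσ hS (fun φ hφ => integrableOn_exp_mul_heatKernel_two hx hφ)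
    ?_ ?_
  · have h1 := tendsto_laplaceExponent_div hσ hC hK
    have hΦ0 := tendsto_laplaceExponent_nhdsGT hσ hC (neg_one_sub_neg hs) hK
    have h2 := (tendsto_resolvent_two hx).comp hΦ0
    -- With `-1 - s = 2q`, the bounded quantity is exactly `log(1/Φ(1/t)) + 2 log(A log(t)^q)`. So
    -- `log(1/Φ)` is equivalent to `-2 log(A log(t)^q)`, whatever the value of `A > 0`.
    have hb := eventually_abs_le_of_tendsto
      (((h1.log one_ne_zero).neg).add_const (2 * Real.log A - Real.log C))
    have h3 := tendsto_div_of_abs_sub_le (N := fun t => Real.log (laplaceExponent σ t⁻¹)⁻¹)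
      (hD.const_mul_atTop two_pos) (by
        filter_upwards [hb, eventually_gt_atTop 1] with t ht0 ht
        have hL := Real.log_pos ht
        have hΦ := hσ.laplaceExponent_pos (inv_pos.2 (one_pos.trans ht))
        have hLp := Real.rpow_pos_of_pos hL (-1 - s)
        rw [Real.log_div hΦ.ne' (by positivity), Real.log_mul hC.ne' hLp.ne',
          Real.log_rpow hL, hp] at ht0
        rw [log_const_mul_log_rpow hA0 ht, Real.log_inv]
        convert ht0 using 2
        ring)
    have h4 := (h1.mul h2).mul h3
    rw [mul_one, mul_one] at h4
    refine h4.congr' ?_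
    have hΦ1 : ∀ᶠ t : ℝ in atTop, laplaceExponent σ t⁻¹ < 1 :=
      (hΦ0.mono_right nhdsWithin_le_nhds).eventually_lt_const one_pos
    filter_upwards [eventually_gt_atTop 1, hΦ1, hD.eventually_gt_atTop 0] with t ht ht1 htD
    have hL := Real.log_pos ht
    have hΦ := hσ.laplaceExponent_pos (inv_pos.2 (one_pos.trans ht))
    have hLp := Real.rpow_pos_of_pos hL (-1 - s)
    have hlog : 0 < Real.log (laplaceExponent σ t⁻¹)⁻¹ :=
      Real.log_pos ((one_lt_inv₀ hΦ).2 ht1)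
    have hne : Real.log (A * Real.log t ^ q) ≠ 0 := fun h => by
      rw [h, neg_zero] at htD
      exact lt_irrefl _ htD
    have hpi := Real.pi_pos
    simp only [Function.comp_apply]
    generalize Real.log (laplaceExponent σ t⁻¹)⁻¹ = b at hlog ⊢
    generalize resolvent x (laplaceExponent σ t⁻¹) = R
    generalize laplaceExponent σ t⁻¹ = a
    field_simp
  · intro c hc
    have h := (tendsto_log_const_mul_rpow_div hc (-1 - s)).mul
      (tendsto_log_rpow_ratio hA0 hq0 hc)
    rw [mul_one] at h
    refine h.congr fun t => ?_
    have hCpi : -(C / Real.pi) ≠ 0 := neg_ne_zero.2 (div_pos hC Real.pi_pos).ne'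
    rw [mul_div_mul_comm, mul_div_mul_comm, div_self hCpi, one_mul]

theorem cesaroMean_isEquivalent_of_three_le (hσ : IsLevyMeasure σ) (hS : IsSubordinator S σ P)
    {C s : ℝ} (hC : 0 < C) (hs : 0 < s)
    (hK : kernelLaplace σ ~[𝓝[>] (0 : ℝ)]
      fun lam => C * lam⁻¹ * Real.log (1 / lam) ^ (-1 - s)) (hd : 3 ≤ d) (hx : x ≠ 0) :
    cesaroMean (subordinatedKernel S P x) ~[atTop]
      fun t => C * Real.Gamma ((d : ℝ) / 2 - 1) / (2 * Real.pi ^ ((d : ℝ) / 2)) *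
        ‖x‖ ^ (2 - (d : ℝ)) * Real.log t ^ (-1 - s) := by
  have hd' : (3 : ℝ) ≤ d := by exact_mod_cast hd
  have hx' : 0 < ‖x‖ := norm_pos_iff.2 hx
  have hG : 0 < Real.Gamma ((d : ℝ) / 2 - 1) := Real.Gamma_pos_of_pos (by linarith)
  have hpi := Real.pi_pos
  refine cesaroMean_isEquivalent hσ hS
    (fun φ hφ => integrableOn_exp_mul_heatKernel_of_three_le hd hx hφ.le) ?_ ?_
  · have h1 := tendsto_laplaceExponent_div hσ hC hK
    have h2 := (tendsto_resolvent_of_three_le hd hx).comp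
      (tendsto_laplaceExponent_nhdsGT hσ hC (neg_one_sub_neg hs) hK)
    set R : ℝ := Real.Gamma ((d : ℝ) / 2 - 1) / (2 * Real.pi ^ ((d : ℝ) / 2)) *
      ‖x‖ ^ (2 - (d : ℝ)) with hR
    have hR0 : 0 < R := by positivity
    have h3 := h1.mul (h2.div_const R)
    rw [div_self hR0.ne', mul_one] at h3
    refine h3.congr fun t => ?_
    rw [Function.comp_apply, div_mul_div_comm]
    congr 1
    rw [hR]
    ring
  · intro c hc
    refine (tendsto_log_const_mul_rpow_div hc (-1 - s)).congr fun t => ?_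
    rw [mul_div_mul_left]
    positivity

end Cesaro

end SubordinatedHeat

theorem mainTheorem3 {Ω : Type*} [MeasurableSpace Ω] (P : Measure Ω) [IsProbabilityMeasure P]
    (σ : Measure ℝ) (hσ : SubordinatedHeat.IsLevyMeasure σ)
    (S : ℝ≥0 → Ω → ℝ) (hS : SubordinatedHeat.IsSubordinator S σ P)
    (C s : ℝ) (hC : 0 < C) (hs : 0 < s)
    (hK : SubordinatedHeat.kernelLaplace σ ~[𝓝[>] (0 : ℝ)]
      fun lam => C * lam⁻¹ * Real.log (1 / lam) ^ (-1 - s)) :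
    (∀ x : EuclideanSpace ℝ (Fin 1),
      SubordinatedHeat.cesaroMean (SubordinatedHeat.subordinatedKernel S P x) ~[atTop]
        fun t => Real.sqrt (C / 2) * Real.log t ^ (-(1 + s) / 2) *
          Real.exp (-(Real.sqrt C * Real.sqrt 2 * ‖x‖ * Real.log t ^ (-(1 + s) / 2)))) ∧
    (∀ x : EuclideanSpace ℝ (Fin 2), x ≠ 0 →
      SubordinatedHeat.cesaroMean (SubordinatedHeat.subordinatedKernel S P x) ~[atTop]
        fun t => -(C / Real.pi) * Real.log t ^ (-1 - s) *
          Real.log (Real.sqrt (2 * C) * ‖x‖ * Real.log t ^ (-(1 + s) / 2))) ∧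
    (∀ d : ℕ, 3 ≤ d → ∀ x : EuclideanSpace ℝ (Fin d), x ≠ 0 →
      SubordinatedHeat.cesaroMean (SubordinatedHeat.subordinatedKernel S P x) ~[atTop]
        fun t => C * Real.Gamma ((d : ℝ) / 2 - 1) / (2 * Real.pi ^ ((d : ℝ) / 2)) *
          ‖x‖ ^ (2 - (d : ℝ)) * Real.log t ^ (-1 - s)) :=
  ⟨fun x => SubordinatedHeat.cesaroMean_isEquivalent_one hσ hS hC hs hK x,
    fun _ hx => SubordinatedHeat.cesaroMean_isEquivalent_two hσ hS hC hs hK hx,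
    fun _ hd _ hx => SubordinatedHeat.cesaroMean_isEquivalent_of_three_le hσ hS hC hs hK hd hx⟩
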